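/- **Setting.** Let $\mathbb T=\mathbb R/\mathbb Z$, let $\|\cdot\|$ denote the usual metrics on $\mathbb T$ and $\mathbb T^2$, and call a homeomorphism minimal if each of its two-sided orbits is dense. Fix a minimal rotation $T(x,y)=(x+a,y+b)$ of $\mathbb T^2$ and $z_0\in\mathbb T^2$. Put $z_{2n}=(x_{2n},y_{2n})=T^nz_0$ and $z_{2n+1}=(x_{2n+1},y_{2n+1})=T^{-n-1}z_0$ for $n\ge 0$, let $\sigma,\tau$ be the bijections of $\mathbb N=\{0,1,\dots\}$ with $Tz_n=z_{\sigma(n)}$, $T^{-1}z_n=z_{\tau(n)}$, and let $X=(\mathbb T\setminus\{x_n\}_n)\times\mathbb T$. Fix also $1=\epsilon_0>\epsilon_1>\cdots\to0$, divisions $\epsilon_{k+1}=c_k^0<c_k^1<c_k^2<c_k^3<c_k^4=\epsilon_k$, and a sequence $(q_k)$ in $[0,1]$ dense in $[0,1]$. For $\alpha\in[0,1]^{\mathbb N}$ let $p_\alpha:(0,1]\to\mathbb R$ be the continuous function with $p_\alpha(1)=-\tfrac14$ which is affine on every $[c_k^{i},c_k^{i+1}]$ ($0\le i\le3$), equals $\alpha(k)/4$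 on $[c_k^0,c_k^1]$ and $q_k/4$ on $[c_k^2,c_k^3]$ if $k\ge1$, and equals $q_0/4$ on $[c_0^0,c_0^1]$ and $\alpha(0)/4$ on $[c_0^2,c_0^3]$. For $0<|t|\le 1$ let $h^\alpha_t:[-1,1]\to[-1,1]$ be the polyline through $(-1,-1)$, $(\frac{-1-|t|}2,-|t|)$, $(-\frac12,-\frac{|t|}2)$, $(-p_\alpha(|t|),\frac{|t|}4)$, $(\frac12,\frac{|t|}2)$, $(\frac{1+|t|}2,|t|)$, $(1,1)$, and let $h^\alpha_0$ be the polyline through $(-1,-1),(-\frac12,0),(\frac12,0),(1,1)$. Given positive reals $\delta_n<2^{-n}$, let $A_n$ be the closed square with centre $z_n$ and half-side $\delta_n$, let $\Lambda_n$ be the identity off $A_n$ and $$\Lambda_n(z_n+(t,s))=z_n+\bigl(t,\;h^\alpha_t\bigl((h^\alpha_{\delta_n})^{-1}(s)\bigr)\bigr)\qquad(|t|,|s|\le\delta_n),$$ and let $\Phi_n=\Lambda_n\circ\cdots\circ\Lambda_0$, $\Phi^\sigma_n=\Lambda_{\sigma(n)}\circ\cdots\circ\Lambda_{\sigma(0)}$,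 $\Phi^\tau_n=\Lambda_{\tau(n)}\circ\cdots\circ\Lambda_{\tau(0)}$. Call $(\delta_n)$ *admissible* for $\alpha$ if: 1. $A_m\cap A_n=\emptyset$ whenever $0<|m-n|\le5$; 2. for all $m<n$: $A_n\cap(\{x_m\}\times\mathbb T)=\emptyset$ and $\delta_n<\|x_m-x_n\|/n$; 3. for all $n\ge1$ and $u,v\in\{x_n\}\times\mathbb T$: $\|\Phi_{n-1}(u)-\Phi_{n-1}(v)\|\le\delta_n$ implies $\|u-v\|<1/n$; 4. there are integers $a_n\ge2$ with $\prod_{n\ge1}(1-1/a_n)>0$ such that for all $1\le n<m$ and $u,v\in\mathbb T^2$ with $\|u-v\|\ge1/n$, $\|\Phi_m(u)-\Phi_m(v)\|\ge\prod_{r=n+1}^m(1-1/a_r)\,\|\Phi_n(u)-\Phi_n(v)\|$; 5. the maps $(\Phi^\sigma_n)^{-1}\circ T\circ\Phi_n$ and $(\Phi^\tau_n)^{-1}\circ T^{-1}\circ\Phi_n$ of $X$ are uniformly continuous on $X$, and both sequences are uniformly Cauchy on $X$. **Statement.** Let $\alpha\in[0,1]^{\mathbb N}$. Admissible sequences for $\alpha$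 exist. For every admissible sequence, $\Phi_n$ converges uniformly to a continuous surjection $\Phi_\alpha:\mathbb T^2\to\mathbb T^2$ which restricts to a bijection of $X$, and $\Phi_\alpha^{-1}(\{w\})$ is a singleton if and only if $w\notin\{z_n\}_n$. The map $\Phi_\alpha^{-1}\circ T\circ\Phi_\alpha$ on $X$ has a unique continuous extension $S_\alpha:\mathbb T^2\to\mathbb T^2$; it is a homeomorphism of $\mathbb T^2$ with $\Phi_\alpha\circ S_\alpha=T\circ\Phi_\alpha$, so that $S_\alpha$ is an almost one-to-one extension of $T$; and $S_\alpha$ is minimal. -/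

import Mathlib

open Set Filter Topology

noncomputable section

namespace TorusMinimal

/-- The torus `𝕋² = (ℝ/ℤ) × (ℝ/ℤ)`. -/
abbrev Torus : Type := UnitAddCircle × UnitAddCircle

/-- The usual (flat, Euclidean) metric of the torus. -/
def torusDist (p q : Torus) : ℝ := Real.sqrt (dist p.1 q.1 ^ 2 + dist p.2 q.2 ^ 2)

/-- A homeomorphism is minimal if every (two-sided) orbit is dense. -/
def IsMinimalHomeo {X : Type*} [TopologicalSpace X] (f : X ≃ₜ X) : Prop :=
  ∀ p : X, Dense (range fun n : ℤ => (f ^ n) p)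

/-- The rotation `(x, y) ↦ (x + a, y + b)`. -/
def rotation (a b : UnitAddCircle) : Torus ≃ₜ Torus := Homeomorph.addRight ((a, b) : Torus)

/-- The choices that are fixed once and for all, before `α` is given. -/
structure Choices where
  /-- the rotation vector `(a, b)` of the minimal rotation `T` -/
  a : UnitAddCircle
  b : UnitAddCircle
  minimal_rotation : IsMinimalHomeo (rotation a b)
  /-- the base point of the distinguished `T`-orbit -/
  z₀ : Torus
  /-- the sequence `1 = ε₀ > ε₁ > ε₂ > ⋯ → 0` -/
  ε : ℕ → ℝ
  ε_zero : ε 0 = 1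
  ε_pos : ∀ n, 0 < ε n
  ε_anti : StrictAnti ε
  ε_lim : Tendsto ε atTop (𝓝 0)
  /-- the division `ε_{k+1} = c k 0 < c k 1 < c k 2 < c k 3 < c k 4 = ε_k` of `[ε_{k+1}, ε_k]`
  into four intervals -/
  c : ℕ → Fin 5 → ℝ
  c_mono : ∀ k, StrictMono (c k)
  c_zero : ∀ k, c k 0 = ε (k + 1)
  c_four : ∀ k, c k 4 = ε k
  /-- the dense sequence in `[0,1]` -/
  q : ℕ → ℝ
  q_mem : ∀ n, q n ∈ Icc (0 : ℝ) 1
  q_dense : Icc (0 : ℝ) 1 ⊆ closure (range q)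

/-- The polyline (piecewise affine function) through a list of vertices with increasing
abscissae. -/
def polyline : List (ℝ × ℝ) → ℝ → ℝ
  | [], _ => 0
  | [v], _ => v.2
  | v :: w :: l, s =>
      if s ≤ w.1 then v.2 + (s - v.1) * ((w.2 - v.2) / (w.1 - v.1)) else polyline (w :: l) s

/-- The bijection of `ℕ` with `T z_n = z_{σ n}`: `2k ↦ 2k+2`, `1 ↦ 0`, `2k+3 ↦ 2k+1`. -/
def sigma (n : ℕ) : ℕ := if n % 2 = 0 then n + 2 else if n = 1 then 0 else n - 2

/-- The bijection of `ℕ` with `T⁻¹ z_n = z_{τ n}`: `0 ↦ 1`, `2k+2 ↦ 2k`, `2k+1 ↦ 2k+3`. -/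
def tau (n : ℕ) : ℕ := if n = 0 then 1 else if n % 2 = 0 then n - 2 else n + 2

/-- The representative in `[-1/2, 1/2)` of a point of the circle. -/
def rep (u : UnitAddCircle) : ℝ := (AddCircle.equivIco (1 : ℝ) (-1 / 2) u : ℝ)

/-- `iter L n = L n ∘ L (n-1) ∘ ⋯ ∘ L 0`. -/
def iter (L : ℕ → Torus → Torus) : ℕ → Torus → Torus
  | 0 => L 0
  | n + 1 => L (n + 1) ∘ iter L n

namespace Choices

variable (D : Choices)

/-- The minimal rotation `T`. -/
def T : Torus ≃ₜ Torus := rotation D.a D.b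

/-- The enumeration `z_{2k} = T^k z₀`, `z_{2k+1} = T^{-k-1} z₀` of the orbit of `z₀`. -/
def z (n : ℕ) : Torus :=
  if n % 2 = 0 then (D.T ^ ((n / 2 : ℕ) : ℤ)) D.z₀ else (D.T ^ (-((n / 2 : ℕ) : ℤ) - 1)) D.z₀

/-- The `T`-invariant comeager set `X = (𝕋 \ {x_n}) × 𝕋`. -/
def X : Set Torus := {p | ∀ n, p.1 ≠ (D.z n).1}

/-- Four times the value of `p_α` on the first of the four parts of `[ε_{k+1}, ε_k]`. -/
def lowVal (α : ℕ → ℝ) (k : ℕ) : ℝ := if k = 0 then D.q 0 else α k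

/-- Four times the value of `p_α` on the third of the four parts of `[ε_{k+1}, ε_k]`. -/
def highVal (α : ℕ → ℝ) (k : ℕ) : ℝ := if k = 0 then α 0 else D.q k

/-- Four times the value of `p_α` at `ε_k`; at `ε₀ = 1` it is the value that makes
`h_1` the identity. -/
def endVal (α : ℕ → ℝ) : ℕ → ℝ
  | 0 => -1
  | k + 1 => D.lowVal α k

/-- The continuous function `p_α` on `(0,1]`: on `[ε_{k+1}, ε_k]` it is constant on the first
and on the third of the four parts and affine on the second and on the fourth. For `0 < t ≤ 1`
the index `k` below is the one with `ε_{k+1} < t ≤ ε_k`. -/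
def p (α : ℕ → ℝ) (t : ℝ) : ℝ :=
  let k := sInf {k : ℕ | D.ε (k + 1) < t}
  polyline
    [(D.c k 0, D.lowVal α k / 4), (D.c k 1, D.lowVal α k / 4),
     (D.c k 2, D.highVal α k / 4), (D.c k 3, D.highVal α k / 4),
     (D.c k 4, D.endVal α k / 4)] t

/-- The function `h^α_t(s)` on `[-1,1]²`, with `h^α_{-t} = h^α_t`. -/
def h (α : ℕ → ℝ) (t s : ℝ) : ℝ :=
  if t = 0 then polyline [(-1, -1), (-1 / 2, 0), (1 / 2, 0), (1, 1)] s
  else polyline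
    [(-1, -1), ((-1 - |t|) / 2, -|t|), (-1 / 2, -|t| / 2), (-D.p α |t|, |t| / 4),
     (1 / 2, |t| / 2), ((1 + |t|) / 2, |t|), (1, 1)] s

/-- The inverse of `h^α_t : [-1,1] → [-1,1]` (used for `t ≠ 0`). -/
def hInv (α : ℕ → ℝ) (t : ℝ) : ℝ → ℝ := Function.invFunOn (D.h α t) (Icc (-1) 1)

/-- The closed square `A_n` with centre `z_n` and half-side `δ_n`. -/
def A (δ : ℕ → ℝ) (n : ℕ) : Set Torus :=
  {u | |rep (u.1 - (D.z n).1)| ≤ δ n ∧ |rep (u.2 - (D.z n).2)| ≤ δ n}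

open Classical in
/-- `Λ_{α,n}(z_n + (t, s)) = z_n + (t, h^α_t((h^α_{δ_n})⁻¹(s)))` on `A_n`, the identity
elsewhere. -/
def Lam (α δ : ℕ → ℝ) (n : ℕ) (u : Torus) : Torus :=
  if u ∈ D.A δ n then
    (u.1, (D.z n).2 +
      ((D.h α (rep (u.1 - (D.z n).1)) (D.hInv α (δ n) (rep (u.2 - (D.z n).2))) : ℝ) :
        UnitAddCircle))
  else u

/-- `Φ_{α,n} = Λ_{α,n} ∘ ⋯ ∘ Λ_{α,0}`. -/
def Phi (α δ : ℕ → ℝ) : ℕ → Torus → Torus := iter (D.Lam α δ)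

/-- `Φ^σ_{α,n} = Λ_{α,σ(n)} ∘ ⋯ ∘ Λ_{α,σ(0)}`. -/
def PhiSigma (α δ : ℕ → ℝ) : ℕ → Torus → Torus := iter fun k => D.Lam α δ (sigma k)

/-- `Φ^τ_{α,n} = Λ_{α,τ(n)} ∘ ⋯ ∘ Λ_{α,τ(0)}`. -/
def PhiTau (α δ : ℕ → ℝ) : ℕ → Torus → Torus := iter fun k => D.Lam α δ (tau k)

/-- `(Φ^σ_{α,n})⁻¹ ∘ T ∘ Φ_{α,n}` on `X`. -/
def Gam (α δ : ℕ → ℝ) (n : ℕ) (u : Torus) : Torus :=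
  Function.invFunOn (D.PhiSigma α δ n) D.X (D.T (D.Phi α δ n u))

/-- `(Φ^τ_{α,n})⁻¹ ∘ T⁻¹ ∘ Φ_{α,n}` on `X`. -/
def Del (α δ : ℕ → ℝ) (n : ℕ) (u : Torus) : Torus :=
  Function.invFunOn (D.PhiTau α δ n) D.X (D.T.symm (D.Phi α δ n u))

/-- The requirements on the sizes `δ_n = δ_{α,n}` of the squares. -/
structure Admissible (α δ : ℕ → ℝ) : Prop where
  pos : ∀ n, 0 < δ n
  disjoint : ∀ m n, m < n → n ≤ m + 5 → Disjoint (D.A δ m) (D.A δ n)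
  lt_pow : ∀ n, δ n < 1 / 2 ^ n
  avoid : ∀ m n, m < n → ∀ u ∈ D.A δ n, u.1 ≠ (D.z m).1
  lt_dist : ∀ m n, m < n → δ n < dist (D.z m).1 (D.z n).1 / n
  fibre : ∀ n, ∀ v w : UnitAddCircle,
    torusDist (D.Phi α δ n ((D.z (n + 1)).1, v)) (D.Phi α δ n ((D.z (n + 1)).1, w)) ≤ δ (n + 1) →
      dist v w < 1 / ((n + 1 : ℕ) : ℝ)
  expand : ∃ a : ℕ → ℕ, (∀ n, 2 ≤ a n) ∧
    (∃ C : ℝ, 0 < C ∧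
      Tendsto (fun N : ℕ => ∏ r ∈ Finset.Icc 1 N, (1 - 1 / (a r : ℝ))) atTop (𝓝 C)) ∧
    ∀ n m : ℕ, 1 ≤ n → n < m → ∀ u v : Torus, 1 / (n : ℝ) ≤ torusDist u v →
      (∏ r ∈ Finset.Icc (n + 1) m, (1 - 1 / (a r : ℝ))) *
          torusDist (D.Phi α δ n u) (D.Phi α δ n v)
        ≤ torusDist (D.Phi α δ m u) (D.Phi α δ m v)
  gam_unifCont : ∀ n, UniformContinuousOn (D.Gam α δ n) D.X
  del_unifCont : ∀ n, UniformContinuousOn (D.Del α δ n) D.X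
  gam_cauchy : UniformCauchySeqOn (D.Gam α δ) atTop D.X
  del_cauchy : UniformCauchySeqOn (D.Del α δ) atTop D.X

/-- `S` agrees on `X` with `Φ⁻¹ ∘ T ∘ Φ`, where `Φ` is inverted as a self-map of `X`. -/
def Extends (Φ S : Torus → Torus) : Prop :=
  ∀ u ∈ D.X, S u = Function.invFunOn Φ D.X (D.T (Φ u))

end Choices

end TorusMinimal

end

/-!
`Λ_n` collapses a vertical segment through `z_n` to that point, because `h_0` collapses
`[-1/2, 1/2]`, and is injective otherwise. Condition 4 keeps distinct points apart under all later
factors once `Φ_n` separates them, so the limit `Φ` identifies only points that some `Φ_n` already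
identifies; this makes it injective off the fibres over the orbit.

In condition 5 the delicate point is that `(Φ^σ_n)⁻¹ ∘ T ∘ Φ_n` extends continuously across the
circle `{x_m} × 𝕋`. The squares at `z_m` and at `T z_m` are built from the same family `h`, and
`h_t ∘ h_δ⁻¹ = (h_t ∘ h_δ'⁻¹) ∘ (h_δ' ∘ h_δ⁻¹)` for `δ = δ_m`, `δ' = δ_{σ(m)}`. Hence
`T ∘ Λ_m = Λ_{σ(m)} ∘ B ∘ T` near the circle, with `B` continuous, and the collapsing factors
`Λ_m` of `Φ_n` and `Λ_{σ(m)}` of `Φ^σ_n` cancel. The enumeration `z_0, T⁻¹z_0, Tz_0, T⁻²z_0, …` of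
the orbit makes `Φ^σ_n` and `Φ_n` differ by at most two factors, whose supports shrink. So each
`δ_n` only has to be chosen small in terms of the earlier ones.

The limits `S`, `S'` of the two sequences satisfy `Φ ∘ S = T ∘ Φ` and `Φ ∘ S' = T⁻¹ ∘ Φ`. They are
mutually inverse because `Φ` is injective over the dense set `X`. The closure of an `S`-orbit has
dense, hence full, image under `Φ`, so it contains `X`, and `S` is minimal.
-/

noncomputable section

namespace TorusMinimal

/-! ### Polylines -/

section Polyline

variable {v w : ℝ × ℝ} {l : List (ℝ × ℝ)} {s : ℝ}

lemma sortedLT_map_fst_cons (hl : ((v :: l).map Prod.fst).SortedLT) :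
    (∀ u ∈ l, v.1 < u.1) ∧ (l.map Prod.fst).SortedLT := by
  have := List.pairwise_cons.1 hl.pairwise
  exact ⟨fun u hu => this.1 _ (List.mem_map_of_mem hu), this.2.sortedLT⟩

lemma polyline_cons_of_le (hs : s ≤ w.1) :
    polyline (v :: w :: l) s = v.2 + (s - v.1) * ((w.2 - v.2) / (w.1 - v.1)) := by
  rw [polyline, if_pos hs]

lemma polyline_cons_of_lt (hs : w.1 < s) : polyline (v :: w :: l) s = polyline (w :: l) s := by
  rw [polyline, if_neg hs.not_ge]

lemma polyline_cons_fst (hl : ((v :: l).map Prod.fst).SortedLT) :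
    polyline (v :: l) v.1 = v.2 := by
  cases l with
  | nil => rfl
  | cons w l =>
    rw [polyline_cons_of_le ((sortedLT_map_fst_cons hl).1 w (by simp)).le]
    simp

lemma polyline_cons_cons_fst (h : v.1 < w.1) : polyline (v :: w :: l) w.1 = w.2 := by
  rw [polyline_cons_of_le le_rfl, mul_div_cancel₀ _ (sub_pos.2 h).ne', add_sub_cancel]

lemma polyline_cons_of_ge (hl : ((v :: w :: l).map Prod.fst).SortedLT) (hs : w.1 ≤ s) :
    polyline (v :: w :: l) s = polyline (w :: l) s := by
  obtain ⟨hv, hl'⟩ := sortedLT_map_fst_cons hl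
  rcases hs.eq_or_lt with rfl | hs
  · rw [polyline_cons_cons_fst (hv w (by simp)), polyline_cons_fst hl']
  · exact polyline_cons_of_lt hs

lemma polyline_append_of_ge {l' : List (ℝ × ℝ)} (hl : ((l' ++ v :: l).map Prod.fst).SortedLT)
    (hs : v.1 ≤ s) : polyline (l' ++ v :: l) s = polyline (v :: l) s := by
  induction l' with
  | nil => rfl
  | cons u l' ih =>
    obtain ⟨-, htail⟩ := sortedLT_map_fst_cons hl
    cases l' with
    | nil => exact polyline_cons_of_ge hl hs
    | cons w l' =>
      have hwv : w.1 < v.1 := (sortedLT_map_fst_cons htail).1 v (by simp)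
      exact (polyline_cons_of_ge hl (hwv.le.trans hs)).trans (ih htail)

lemma polyline_vertex (hl : (l.map Prod.fst).SortedLT) (hv : v ∈ l) : polyline l v.1 = v.2 := by
  obtain ⟨l₁, l₂, rfl⟩ := List.append_of_mem hv
  rw [polyline_append_of_ge hl le_rfl]
  rw [List.map_append] at hl
  exact polyline_cons_fst (List.pairwise_append.1 hl.pairwise).2.1.sortedLT

lemma fst_le_fst_getLast (hl : ((v :: l).map Prod.fst).SortedLT) :
    v.1 ≤ ((v :: l).getLast (by simp)).1 := by
  rcases List.mem_cons.1 (List.getLast_mem (List.cons_ne_nil v l)) with h | h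
  · rw [h]
  · exact ((sortedLT_map_fst_cons hl).1 _ h).le

lemma polyline_strictMonoOn (hfst : ((v :: l).map Prod.fst).SortedLT)
    (hsnd : ((v :: l).map Prod.snd).SortedLT) :
    StrictMonoOn (polyline (v :: l)) (Icc v.1 ((v :: l).getLast (by simp)).1) := by
  induction l generalizing v with
  | nil => simp
  | cons w l ih =>
    obtain ⟨hv, hfst'⟩ := sortedLT_map_fst_cons hfst
    obtain ⟨hv₂, hsnd'⟩ := List.pairwise_cons.1 hsnd.pairwise
    have hvw : v.1 < w.1 := hv w (by simp)
    have hslope : 0 < (w.2 - v.2) / (w.1 - v.1) :=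
      div_pos (sub_pos.2 (hv₂ w.2 (by simp))) (sub_pos.2 hvw)
    have hleft : StrictMonoOn (polyline (v :: w :: l)) (Icc v.1 w.1) := fun x hx y hy hxy => by
      rw [polyline_cons_of_le hx.2, polyline_cons_of_le hy.2]
      gcongr
    have hright : StrictMonoOn (polyline (v :: w :: l)) (Icc w.1 ((w :: l).getLast (by simp)).1) :=
      (ih hfst' hsnd'.sortedLT).congr fun s hs => (polyline_cons_of_ge hfst hs.1).symm
    have hw := fst_le_fst_getLast hfst'
    rw [List.getLast_cons_cons, ← Icc_union_Icc_eq_Icc hvw.le hw]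
    exact hleft.union hright (isGreatest_Icc hvw.le) (isLeast_Icc hw)

lemma affine_mem_Icc {a b x y u v s : ℝ} (hs : s ∈ Icc x y) (hu : u ∈ Icc a b)
    (hv : v ∈ Icc a b) : u + (s - x) * ((v - u) / (y - x)) ∈ Icc a b := by
  rw [← mul_div_assoc, mul_div_right_comm]
  have hyx : 0 ≤ y - x := sub_nonneg.2 (hs.1.trans hs.2)
  simpa using (convex_Icc a b).add_smul_sub_mem hu hv (t := (s - x) / (y - x))
    ⟨div_nonneg (sub_nonneg.2 hs.1) hyx, div_le_one_of_le₀ (sub_le_sub_right hs.2 x) hyx⟩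

lemma polyline_mem_Icc {a b : ℝ} (hb : ∀ w ∈ v :: l, w.2 ∈ Icc a b) (hs : v.1 ≤ s) :
    polyline (v :: l) s ∈ Icc a b := by
  induction l generalizing v with
  | nil => exact hb v (by simp)
  | cons w l ih =>
    rcases le_or_gt s w.1 with h | h
    · rw [polyline_cons_of_le h]
      exact affine_mem_Icc ⟨hs, h⟩ (hb v (by simp)) (hb w (by simp))
    · rw [polyline_cons_of_lt h]
      exact ih (fun u hu => hb u (by simp [hu])) h.le

lemma continuous_polyline_param {P : Type*} [TopologicalSpace P] {l : List (P → ℝ × ℝ)}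
    (hl : ∀ p, ((l.map fun f => f p).map Prod.fst).SortedLT) (hc : ∀ f ∈ l, Continuous f) :
    Continuous fun q : P × ℝ => polyline (l.map fun f => f q.1) q.2 := by
  induction l with
  | nil => simpa only [List.map_nil, polyline] using continuous_const
  | cons f l ih =>
    have hf : Continuous f := hc f (by simp)
    cases l with
    | nil =>
      simp only [List.map_cons, List.map_nil, polyline]
      fun_prop
    | cons g l =>
      have hg : Continuous g := hc g (by simp)
      have hfg : ∀ p, (f p).1 < (g p).1 := fun p =>
        (sortedLT_map_fst_cons (hl p)).1 (g p) (by simp)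
      have hslope : ∀ q : P × ℝ, (g q.1).1 - (f q.1).1 ≠ 0 := fun q => (sub_pos.2 (hfg q.1)).ne'
      have htail := ih (fun p => (sortedLT_map_fst_cons (hl p)).2) fun k hk => hc k (by simp [hk])
      refine Continuous.if_le ?_ htail continuous_snd (by fun_prop) fun q hq => ?_
      · fun_prop (disch := assumption)
      · beta_reduce at hq ⊢
        rw [hq, polyline_cons_fst (sortedLT_map_fst_cons (hl q.1)).2,
          mul_div_cancel₀ _ (hslope q), add_sub_cancel]

lemma continuous_polyline (hl : (l.map Prod.fst).SortedLT) : Continuous (polyline l) := by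
  have h := continuous_polyline_param (P := Unit) (l := l.map fun v _ => v)
    (by simpa [Function.comp_def] using hl)
    (by simp only [List.mem_map]; rintro _ ⟨v, -, rfl⟩; exact continuous_const)
  simpa [Function.comp_def] using h.comp (Continuous.prodMk_right ())

end Polyline

/-! ### The functions `p_α` and `h^α_t` -/

namespace Choices

section ProfileFunctions

variable (D : Choices) {α : ℕ → ℝ} {k : ℕ} {t s : ℝ}

lemma lowVal_mem_Icc (hα : ∀ n, α n ∈ Icc (0 : ℝ) 1) (k : ℕ) : D.lowVal α k ∈ Icc (0 : ℝ) 1 := by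
  unfold lowVal
  split_ifs
  exacts [D.q_mem 0, hα k]

lemma highVal_mem_Icc (hα : ∀ n, α n ∈ Icc (0 : ℝ) 1) (k : ℕ) :
    D.highVal α k ∈ Icc (0 : ℝ) 1 := by
  unfold highVal
  split_ifs
  exacts [hα 0, D.q_mem k]

lemma endVal_mem_Icc (hα : ∀ n, α n ∈ Icc (0 : ℝ) 1) (k : ℕ) :
    D.endVal α k ∈ Icc (-1 : ℝ) 1 := by
  cases k with
  | zero => simp [endVal]
  | succ k => exact Icc_subset_Icc_left (by norm_num) (D.lowVal_mem_Icc hα k)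

/-- The vertices of the graph of `p_α` over `[ε_{k+1}, ε_k]`. -/
def pVertices (α : ℕ → ℝ) (k : ℕ) : List (ℝ × ℝ) :=
  [(D.c k 0, D.lowVal α k / 4), (D.c k 1, D.lowVal α k / 4),
   (D.c k 2, D.highVal α k / 4), (D.c k 3, D.highVal α k / 4),
   (D.c k 4, D.endVal α k / 4)]

lemma pVertices_sorted (α : ℕ → ℝ) (k : ℕ) : ((D.pVertices α k).map Prod.fst).SortedLT := by
  simp only [List.sortedLT_iff_isChain, pVertices, List.map_cons, List.map_nil,
    List.isChain_cons_cons, List.IsChain.singleton, and_true]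
  refine ⟨?_, ?_, ?_, ?_⟩ <;> exact D.c_mono k (by decide)

lemma p_eq_of_mem_Ioc (ht : t ∈ Ioc (D.ε (k + 1)) (D.ε k)) :
    D.p α t = polyline (D.pVertices α k) t := by
  have hk : IsLeast {j : ℕ | D.ε (j + 1) < t} k := by
    refine ⟨ht.1, fun j (hj : D.ε (j + 1) < t) => ?_⟩
    have : D.ε (j + 1) < D.ε k := hj.trans_le ht.2
    exact Nat.lt_succ_iff.1 (D.ε_anti.lt_iff_gt.1 this)
  simp only [p, hk.csInf_eq, pVertices]

lemma p_eq_of_mem_Icc (ht : t ∈ Icc (D.ε (k + 1)) (D.ε k)) :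
    D.p α t = polyline (D.pVertices α k) t := by
  rcases ht.1.eq_or_lt with rfl | hlt
  · have hright : polyline (D.pVertices α (k + 1)) (D.c (k + 1) 4) = D.lowVal α k / 4 :=
      polyline_vertex (v := (_, _)) (D.pVertices_sorted α (k + 1)) (by simp [pVertices, endVal])
    have hleft : polyline (D.pVertices α k) (D.c k 0) = D.lowVal α k / 4 :=
      polyline_vertex (v := (_, _)) (D.pVertices_sorted α k) (by simp [pVertices])
    rw [c_four] at hright
    rw [c_zero] at hleft
    rw [D.p_eq_of_mem_Ioc ⟨D.ε_anti (Nat.lt_succ_self _), le_rfl⟩, hright, hleft]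
  · exact D.p_eq_of_mem_Ioc ⟨hlt, ht.2⟩

lemma exists_mem_Ioc_ε (ht : t ∈ Ioc 0 1) : ∃ k, t ∈ Ioc (D.ε (k + 1)) (D.ε k) := by
  classical
  have hex : ∃ k, D.ε k < t := (D.ε_lim.eventually (gt_mem_nhds ht.1)).exists
  obtain ⟨k, hk⟩ : ∃ k, Nat.find hex = k + 1 := Nat.exists_eq_succ_of_ne_zero fun h0 => by
    have := Nat.find_spec hex
    rw [h0, D.ε_zero] at this
    exact this.not_ge ht.2
  exact ⟨k, hk ▸ Nat.find_spec hex, not_lt.1 (Nat.find_min hex (by omega))⟩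

lemma exists_mem_Ico_ε (ht : t ∈ Ioo 0 1) : ∃ k, t ∈ Ico (D.ε (k + 1)) (D.ε k) := by
  obtain ⟨k, hk⟩ := D.exists_mem_Ioc_ε ⟨ht.1, ht.2.le⟩
  rcases hk.2.eq_or_lt with rfl | hlt
  · cases k with
    | zero => exact absurd D.ε_zero ht.2.ne
    | succ k => exact ⟨k, le_rfl, D.ε_anti (Nat.lt_succ_self _)⟩
  · exact ⟨k, hk.1.le, hlt⟩

lemma continuousAt_p (ht : t ∈ Ioo 0 1) : ContinuousAt (D.p α) t := by
  have hpoly := fun k => continuous_polyline (D.pVertices_sorted α k)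
  rw [continuousAt_iff_continuous_left_right]
  constructor
  · obtain ⟨k, hk⟩ := D.exists_mem_Ioc_ε ⟨ht.1, ht.2.le⟩
    refine (hpoly k).continuousWithinAt.congr_of_eventuallyEq ?_ (D.p_eq_of_mem_Ioc hk)
    filter_upwards [self_mem_nhdsWithin, mem_nhdsWithin_of_mem_nhds (lt_mem_nhds hk.1)]
      with s hs hs' using D.p_eq_of_mem_Ioc ⟨hs', le_trans hs hk.2⟩
  · obtain ⟨k, hk⟩ := D.exists_mem_Ico_ε ht
    refine (hpoly k).continuousWithinAt.congr_of_eventuallyEq ?_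
      (D.p_eq_of_mem_Icc (Ico_subset_Icc_self hk))
    filter_upwards [self_mem_nhdsWithin, mem_nhdsWithin_of_mem_nhds (gt_mem_nhds hk.2)]
      with s hs hs' using D.p_eq_of_mem_Icc ⟨le_trans hk.1 hs, hs'.le⟩

lemma p_mem_Icc (hα : ∀ n, α n ∈ Icc (0 : ℝ) 1) (ht : t ∈ Ioc 0 1) :
    D.p α t ∈ Icc (-(1 / 4) : ℝ) (1 / 4) := by
  obtain ⟨k, hk⟩ := D.exists_mem_Ioc_ε ht
  rw [D.p_eq_of_mem_Ioc hk]
  refine polyline_mem_Icc ?_ (by rw [D.c_zero]; exact hk.1.le)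
  have hlow := D.lowVal_mem_Icc hα k
  have hhigh := D.highVal_mem_Icc hα k
  have hend := D.endVal_mem_Icc hα k
  simp only [mem_Icc] at hlow hhigh hend
  simp only [List.forall_mem_cons, mem_Icc]
  refine ⟨?_, ?_, ?_, ?_, ?_, by simp⟩ <;> constructor <;> linarith

/-- The vertices of the graph of `h^α_t` for `t > 0`. -/
def hVertices (α : ℕ → ℝ) (t : ℝ) : List (ℝ × ℝ) :=
  [(-1, -1), ((-1 - t) / 2, -t), (-1 / 2, -t / 2), (-D.p α t, t / 4),
   (1 / 2, t / 2), ((1 + t) / 2, t), (1, 1)]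

lemma h_eq_polyline (ht : t ≠ 0) (s : ℝ) : D.h α t s = polyline (D.hVertices α |t|) s := by
  simp only [h, if_neg ht, hVertices]

lemma h_abs (t s : ℝ) : D.h α |t| s = D.h α t s := by
  simp only [h, abs_eq_zero, abs_abs]

lemma h_zero (s : ℝ) : D.h α 0 s =
    if s ≤ -1 / 2 then 2 * s + 1 else if s ≤ 1 / 2 then 0 else if s ≤ 1 then 2 * s - 1 else 1 := by
  simp only [h, if_true, polyline]
  split_ifs <;> ring

lemma h_of_le (ht : |t| < 1) (hs : s ≤ (-1 - |t|) / 2) : D.h α t s = 2 * s + 1 := by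
  rcases eq_or_ne t 0 with rfl | h0
  · rw [h_zero, if_pos (by simpa using hs)]
  · have hslope : (-|t| - -1) / ((-1 - |t|) / 2 - -1) = 2 := by
      rw [div_eq_iff (by linarith)]
      ring
    rw [D.h_eq_polyline h0, hVertices, polyline_cons_of_le hs, hslope]
    ring

lemma h_neg_one (ht : |t| < 1) : D.h α t (-1) = -1 := by
  rw [D.h_of_le ht (by linarith)]
  norm_num

section

variable (hα : ∀ n, α n ∈ Icc (0 : ℝ) 1)
include hα

lemma hVertices_sorted (ht : t ∈ Ioo 0 1) :
    ((D.hVertices α t).map Prod.fst).SortedLT ∧ ((D.hVertices α t).map Prod.snd).SortedLT := by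
  obtain ⟨hp, hp'⟩ := D.p_mem_Icc hα ⟨ht.1, ht.2.le⟩
  obtain ⟨h0, h1⟩ := ht
  simp only [List.sortedLT_iff_isChain, hVertices, List.map_cons, List.map_nil,
    List.isChain_cons_cons, List.IsChain.singleton, and_true]
  refine ⟨⟨?_, ?_, ?_, ?_, ?_, ?_⟩, ?_, ?_, ?_, ?_, ?_, ?_⟩ <;> linarith

lemma h_vertex (h0 : t ≠ 0) (ht : |t| < 1) {x y : ℝ} (h : (x, y) ∈ D.hVertices α |t|) :
    D.h α t x = y := by
  rw [D.h_eq_polyline h0]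
  exact polyline_vertex (D.hVertices_sorted hα ⟨abs_pos.2 h0, ht⟩).1 h

lemma h_of_ge (ht : |t| < 1) (hs : s ∈ Icc ((1 + |t|) / 2) 1) : D.h α t s = 2 * s - 1 := by
  rcases eq_or_ne t 0 with rfl | h0
  · have hs' : 1 / 2 ≤ s := by simpa using hs.1
    have hs1 := hs.2
    rw [h_zero]
    split_ifs <;> linarith
  · have hslope : (1 - |t|) / (1 - (1 + |t|) / 2) = 2 := by
      rw [div_eq_iff (by linarith)]
      ring
    have hlast : polyline (D.hVertices α |t|) s = polyline [((1 + |t|) / 2, |t|), (1, 1)] s :=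
      polyline_append_of_ge (l' := (D.hVertices α |t|).take 5)
        (D.hVertices_sorted hα ⟨abs_pos.2 h0, ht⟩).1 hs.1
    rw [D.h_eq_polyline h0, hlast, polyline_cons_of_le hs.2, hslope]
    ring

lemma h_one (ht : |t| < 1) : D.h α t 1 = 1 := by
  rw [D.h_of_ge hα ht ⟨by linarith, le_rfl⟩]
  norm_num

lemma h_strictMonoOn (h0 : t ≠ 0) (ht : |t| < 1) : StrictMonoOn (D.h α t) (Icc (-1) 1) := by
  obtain ⟨hfst, hsnd⟩ := D.hVertices_sorted hα ⟨abs_pos.2 h0, ht⟩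
  exact (polyline_strictMonoOn hfst hsnd).congr fun s _ => (D.h_eq_polyline h0 s).symm

lemma h_monotoneOn (ht : |t| < 1) : MonotoneOn (D.h α t) (Icc (-1) 1) := by
  rcases eq_or_ne t 0 with rfl | h0
  · rintro x ⟨-, -⟩ y ⟨-, hy⟩ hxy
    rw [h_zero, h_zero]
    split_ifs <;> linarith
  · exact (D.h_strictMonoOn hα h0 ht).monotoneOn

lemma abs_h_sub_h_zero_le (ht : |t| < 1) (hs : s ∈ Icc (-1 : ℝ) 1) :
    |D.h α t s - D.h α 0 s| ≤ |t| := by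
  rcases eq_or_ne t 0 with rfl | h0
  · simp
  have htpos := abs_pos.2 h0
  have hmono := D.h_monotoneOn hα ht
  have vertex : ∀ {x y}, (x, y) ∈ D.hVertices α |t| → D.h α t x = y := D.h_vertex hα h0 ht
  rw [h_zero, abs_le]
  rcases le_total s ((-1 - |t|) / 2) with hs₁ | hs₁
  · rw [D.h_of_le ht hs₁, if_pos (by linarith)]
    constructor <;> linarith
  rcases le_total ((1 + |t|) / 2) s with hs₂ | hs₂
  · rw [D.h_of_ge hα ht ⟨hs₂, hs.2⟩, if_neg (by linarith), if_neg (by linarith), if_pos hs.2]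
    constructor <;> linarith
  have hlow : -|t| ≤ D.h α t s := by
    rw [← vertex (x := (-1 - |t|) / 2) (y := -|t|) (by simp [hVertices])]
    exact hmono ⟨by linarith, by linarith⟩ hs hs₁
  have hupp : D.h α t s ≤ |t| := by
    rw [← vertex (x := (1 + |t|) / 2) (y := |t|) (by simp [hVertices])]
    exact hmono hs ⟨by linarith, by linarith⟩ hs₂
  split_ifs with hs₃ hs₄ hs₅
  · have : D.h α t s ≤ -|t| / 2 := by
      rw [← vertex (x := -1 / 2) (y := -|t| / 2) (by simp [hVertices])]
      exact hmono hs (by norm_num) hs₃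
    constructor <;> linarith
  · constructor <;> linarith
  · have : |t| / 2 ≤ D.h α t s := by
      rw [← vertex (x := 1 / 2) (y := |t| / 2) (by simp [hVertices])]
      exact hmono (by norm_num) hs (not_le.1 hs₄).le
    constructor <;> linarith
  · exact absurd hs.2 hs₅

end

lemma continuous_h_zero (α : ℕ → ℝ) : Continuous (D.h α 0) := by
  have h0 : D.h α 0 = polyline [(-1, -1), (-1 / 2, 0), (1 / 2, 0), (1, 1)] := by
    ext s
    simp only [h, if_true]
  rw [h0]
  refine continuous_polyline ?_
  simp only [List.sortedLT_iff_isChain, List.map_cons, List.map_nil, List.isChain_cons_cons,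
    List.IsChain.singleton, and_true]
  norm_num

section

variable (hα : ∀ n, α n ∈ Icc (0 : ℝ) 1)
include hα

lemma continuous_polyline_hVertices :
    Continuous fun q : Ioo (0 : ℝ) 1 × ℝ => polyline (D.hVertices α q.1) q.2 := by
  have hp : Continuous fun t : Ioo (0 : ℝ) 1 => D.p α t :=
    continuousOn_iff_continuous_domRestrict.1 fun t ht => (D.continuousAt_p ht).continuousWithinAt
  refine continuous_polyline_param (P := Ioo (0 : ℝ) 1) (l := [fun _ => (-1, -1),
    fun t => ((-1 - (t : ℝ)) / 2, -(t : ℝ)), fun t => (-1 / 2, -(t : ℝ) / 2),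
    fun t => (-D.p α t, (t : ℝ) / 4), fun t => (1 / 2, (t : ℝ) / 2),
    fun t => ((1 + (t : ℝ)) / 2, (t : ℝ)), fun _ => (1, 1)])
    (fun t => (D.hVertices_sorted hα t.2).1) ?_
  simp only [List.forall_mem_cons]
  refine ⟨?_, ?_, ?_, ?_, ?_, ?_, ?_, by simp⟩ <;> fun_prop

lemma continuousAt_h (h0 : t ≠ 0) (ht : |t| < 1) (s : ℝ) :
    ContinuousAt (fun q : ℝ × ℝ => D.h α q.1 q.2) (t, s) := by
  set U : Set ℝ := {t | t ≠ 0 ∧ |t| < 1}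
  have hU : IsOpen U := isOpen_ne.inter (isOpen_lt continuous_abs continuous_const)
  suffices ContinuousOn (fun q : ℝ × ℝ => D.h α q.1 q.2) (U ×ˢ univ) from
    this.continuousAt ((hU.prod isOpen_univ).mem_nhds ⟨⟨h0, ht⟩, mem_univ _⟩)
  rw [continuousOn_iff_continuous_domRestrict]
  have habs : Continuous fun q : (U ×ˢ (univ : Set ℝ) : Set (ℝ × ℝ)) =>
      ((⟨|q.1.1|, abs_pos.2 q.2.1.1, q.2.1.2⟩ : Ioo (0 : ℝ) 1), q.1.2) := by fun_prop
  exact ((D.continuous_polyline_hVertices hα).comp habs).congr fun q =>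
    (D.h_eq_polyline q.2.1.1 _).symm

lemma continuousOn_h :
    ContinuousOn (fun q : ℝ × ℝ => D.h α q.1 q.2) (Ioo (-1) 1 ×ˢ Icc (-1) 1) := by
  rintro ⟨t, s⟩ ⟨ht, -⟩
  rcases eq_or_ne t 0 with rfl | h0
  · have hzero : ContinuousWithinAt (fun q : ℝ × ℝ => D.h α 0 q.2) (Ioo (-1) 1 ×ˢ Icc (-1) 1)
        (0, s) := ((D.continuous_h_zero α).comp continuous_snd).continuousWithinAt
    refine hzero.congr_dist (squeeze_zero' (g := fun q : ℝ × ℝ => |q.1|)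
      (.of_forall fun _ => dist_nonneg) ?_ ?_)
    · filter_upwards [self_mem_nhdsWithin] with q hq
      rw [dist_comm]
      exact D.abs_h_sub_h_zero_le hα (abs_lt.2 hq.1) hq.2
    · have : Continuous fun q : ℝ × ℝ => |q.1| := by fun_prop
      simpa using (this.tendsto ((0 : ℝ), s)).mono_left nhdsWithin_le_nhds
  · exact (D.continuousAt_h hα h0 (abs_lt.2 ht) s).continuousWithinAt

lemma h_bijOn (h0 : t ≠ 0) (ht : |t| < 1) : BijOn (D.h α t) (Icc (-1) 1) (Icc (-1) 1) := by
  have hmono := D.h_strictMonoOn hα h0 ht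
  refine ⟨?_, hmono.injOn, ?_⟩
  · simpa only [MapsTo, D.h_one hα ht, D.h_neg_one ht] using hmono.monotoneOn.mapsTo_Icc
  · have hcont : ContinuousOn (D.h α t) (Icc (-1) 1) :=
      (D.continuousOn_h hα).comp (f := fun s => (t, s)) (by fun_prop) fun s hs => ⟨abs_lt.1 ht, hs⟩
    simpa only [SurjOn, D.h_one hα ht, D.h_neg_one ht] using
      intermediate_value_Icc (by norm_num : (-1 : ℝ) ≤ 1) hcont

end

end ProfileFunctions

section Inverse

variable (D : Choices) {α : ℕ → ℝ} (hα : ∀ n, α n ∈ Icc (0 : ℝ) 1) {d s : ℝ}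
  (hd : d ∈ Ioo (0 : ℝ) 1)
include hα hd

lemma h_bijOn_of_mem_Ioo : BijOn (D.h α d) (Icc (-1) 1) (Icc (-1) 1) :=
  D.h_bijOn hα hd.1.ne' ((abs_of_pos hd.1).trans_lt hd.2)

lemma h_hInv (hs : s ∈ Icc (-1 : ℝ) 1) : D.h α d (D.hInv α d s) = s :=
  (D.h_bijOn_of_mem_Ioo hα hd).invOn_invFunOn.2 hs

lemma hInv_h (hs : s ∈ Icc (-1 : ℝ) 1) : D.hInv α d (D.h α d s) = s :=
  (D.h_bijOn_of_mem_Ioo hα hd).invOn_invFunOn.1 hs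

lemma hInv_bijOn : BijOn (D.hInv α d) (Icc (-1) 1) (Icc (-1) 1) :=
  (D.h_bijOn_of_mem_Ioo hα hd).symm (D.h_bijOn_of_mem_Ioo hα hd).invOn_invFunOn.symm

lemma hInv_of_ge (hs : s ∈ Icc d 1) : D.hInv α d s = (1 + s) / 2 := by
  have habs : |d| = d := abs_of_pos hd.1
  have hh : D.h α d ((1 + s) / 2) = s := by
    rw [D.h_of_ge hα (habs.trans_lt hd.2) ⟨by linarith [hs.1], by linarith [hs.2]⟩]
    ring
  nth_rw 1 [← hh]
  exact D.hInv_h hα hd ⟨by linarith [hd.1, hs.1], by linarith [hs.2]⟩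

lemma hInv_of_le (hs : s ∈ Icc (-1) (-d)) : D.hInv α d s = (-1 + s) / 2 := by
  have habs : |d| = d := abs_of_pos hd.1
  have hh : D.h α d ((-1 + s) / 2) = s := by
    rw [D.h_of_le (habs.trans_lt hd.2) (by linarith [hs.2])]
    ring
  nth_rw 1 [← hh]
  exact D.hInv_h hα hd ⟨by linarith [hs.1], by linarith [hd.1, hs.2]⟩

lemma hInv_strictMonoOn : StrictMonoOn (D.hInv α d) (Icc (-1) 1) := fun x hx y hy hxy => by
  rwa [← (D.h_strictMonoOn hα hd.1.ne' ((abs_of_pos hd.1).trans_lt hd.2)).lt_iff_lt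
    ((D.hInv_bijOn hα hd).mapsTo hx) ((D.hInv_bijOn hα hd).mapsTo hy),
    D.h_hInv hα hd hx, D.h_hInv hα hd hy]

lemma continuousOn_hInv : ContinuousOn (D.hInv α d) (Icc (-1) 1) := by
  have : OrdConnected (D.hInv α d '' Icc (-1) 1) := by
    rw [(D.hInv_bijOn hα hd).image_eq]
    exact ordConnected_Icc
  rw [continuousOn_iff_continuous_domRestrict]
  exact continuous_subtype_val.comp ((D.hInv_strictMonoOn hα hd).orderIso _ _).continuous

end Inverse

end Choices

/-! ### The maps `Λ_n` -/

lemma rep_mem_Ico (u : UnitAddCircle) : rep u ∈ Ico (-1 / 2 : ℝ) (1 / 2) := by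
  have := (AddCircle.equivIco (1 : ℝ) (-1 / 2) u).2
  norm_num at this ⊢
  exact this

lemma rep_mem_Icc (u : UnitAddCircle) : rep u ∈ Icc (-1 : ℝ) 1 :=
  ⟨by linarith [(rep_mem_Ico u).1], by linarith [(rep_mem_Ico u).2]⟩

@[simp] lemma coe_rep (u : UnitAddCircle) : ((rep u : ℝ) : UnitAddCircle) = u :=
  (AddCircle.equivIco (1 : ℝ) (-1 / 2)).symm_apply_apply u

lemma rep_injective : Function.Injective rep :=
  Function.LeftInverse.injective coe_rep

lemma rep_coe {s : ℝ} (hs : s ∈ Ico (-1 / 2 : ℝ) (1 / 2)) : rep (s : UnitAddCircle) = s := by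
  have hs' : s ∈ Ico (-1 / 2 : ℝ) (-1 / 2 + 1) := by norm_num at hs ⊢; exact hs
  exact congrArg Subtype.val ((AddCircle.equivIco (1 : ℝ) (-1 / 2)).apply_symm_apply ⟨s, hs'⟩)

lemma abs_rep (u : UnitAddCircle) : |rep u| = ‖u‖ := by
  have hle : |rep u| ≤ |(1 : ℝ)| / 2 := by
    rw [abs_one, abs_le]
    constructor <;> linarith [(rep_mem_Ico u).1, (rep_mem_Ico u).2]
  rw [← (AddCircle.norm_coe_eq_abs_iff 1 one_ne_zero).2 hle, coe_rep]

lemma continuousAt_rep {u : UnitAddCircle} (hu : u ≠ ((-1 / 2 : ℝ) : UnitAddCircle)) :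
    ContinuousAt rep u :=
  continuous_subtype_val.continuousAt.comp (AddCircle.continuousAt_equivIco 1 (-1 / 2) hu)

/- `rep` jumps at `1/2`, but near that point the composite is the second projection. -/
lemma continuousOn_coe_comp_rep {P : Type*} [TopologicalSpace P] {β : P × ℝ → ℝ} {S : Set P}
    {c : ℝ} (hβ : ContinuousOn β (S ×ˢ Ico (-1 / 2) (1 / 2))) (hc : c < 1 / 2)
    (hfix : ∀ p ∈ S, ∀ r ∈ Ico (-1 / 2 : ℝ) (1 / 2), c ≤ |r| → β (p, r) = r) :
    ContinuousOn (fun q : P × UnitAddCircle => (β (q.1, rep q.2) : UnitAddCircle))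
      (S ×ˢ univ) := by
  rintro ⟨p, v⟩ ⟨hp, -⟩
  by_cases hv : v = ((-1 / 2 : ℝ) : UnitAddCircle)
  · have hcv : c < ‖v‖ := by
      rw [← abs_rep, hv, rep_coe (by norm_num), abs_of_neg (by norm_num)]
      linarith
    have hsnd : ∀ q ∈ S ×ˢ (univ : Set UnitAddCircle), c < ‖q.2‖ →
        (β (q.1, rep q.2) : UnitAddCircle) = q.2 := fun q hq hcq => by
      rw [hfix q.1 hq.1 _ (rep_mem_Ico _) (by rw [abs_rep]; exact hcq.le), coe_rep]
    have hnear : ∀ᶠ q : P × UnitAddCircle in 𝓝[S ×ˢ univ] (p, v), c < ‖q.2‖ :=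
      (continuous_norm.comp continuous_snd).continuousWithinAt.eventually (lt_mem_nhds hcv)
    refine continuous_snd.continuousWithinAt.congr_of_eventuallyEq (f := Prod.snd) ?_
      (hsnd _ ⟨hp, mem_univ _⟩ hcv)
    filter_upwards [self_mem_nhdsWithin, hnear] with q hq hcq using hsnd q hq hcq
  · have hpair : ContinuousWithinAt (fun q : P × UnitAddCircle => (q.1, rep q.2))
        (S ×ˢ univ) (p, v) :=
      continuous_fst.continuousWithinAt.prodMk
        ((continuousAt_rep hv).comp (f := Prod.snd) continuousAt_snd).continuousWithinAt
    exact (AddCircle.continuous_mk' 1).continuousAt.comp_continuousWithinAt <|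
      ContinuousWithinAt.comp (t := S ×ˢ Ico (-1 / 2) (1 / 2))
        (hβ (p, rep v) ⟨hp, rep_mem_Ico v⟩) hpair fun q hq => ⟨hq.1, rep_mem_Ico q.2⟩

namespace Choices

variable (D : Choices) {α : ℕ → ℝ}

/-- The interval map `h^α_t ∘ (h^α_d)⁻¹` from which `Λ_n` is built, with `d = δ_n`. -/
def profileMap (α : ℕ → ℝ) (d t s : ℝ) : ℝ := D.h α t (D.hInv α d s)

lemma profileMap_abs (d t s : ℝ) : D.profileMap α d |t| s = D.profileMap α d t s := D.h_abs _ _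

section ProfileMap

variable (hα : ∀ n, α n ∈ Icc (0 : ℝ) 1) {c d t s : ℝ} (hd : d ∈ Ioo (0 : ℝ) 1)
include hα hd

lemma profileMap_self (hs : s ∈ Icc (-1 : ℝ) 1) : D.profileMap α d d s = s :=
  D.h_hInv hα hd hs

lemma profileMap_comp {e : ℝ} (he : e ∈ Ioo (0 : ℝ) 1) (t : ℝ) (hs : s ∈ Icc (-1 : ℝ) 1) :
    D.profileMap α e t (D.profileMap α d e s) = D.profileMap α d t s := by
  rw [profileMap, profileMap, D.hInv_h hα he ((D.hInv_bijOn hα hd).mapsTo hs), profileMap]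

lemma profileMap_eq_self (hdc : d ≤ c) (hc : c < 1) (ht : |t| ≤ c) (hcs : c ≤ |s|)
    (hs : |s| ≤ 1) : D.profileMap α d t s = s := by
  rcases le_total 0 s with h0 | h0
  · rw [abs_of_nonneg h0] at hcs hs
    rw [profileMap, D.hInv_of_ge hα hd ⟨by linarith, hs⟩,
      D.h_of_ge hα (by linarith) ⟨by linarith, by linarith⟩]
    ring
  · rw [abs_of_nonpos h0] at hcs hs
    rw [profileMap, D.hInv_of_le hα hd ⟨by linarith, by linarith⟩,
      D.h_of_le (by linarith) (by linarith)]
    ring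

lemma profileMap_monotoneOn (ht : |t| < 1) : MonotoneOn (D.profileMap α d t) (Icc (-1) 1) :=
  (D.h_monotoneOn hα ht).comp (D.hInv_strictMonoOn hα hd).monotoneOn (D.hInv_bijOn hα hd).mapsTo

lemma profileMap_apply_of_eq (hdc : d ≤ c) (hc : c < 1) (ht : |t| ≤ c) :
    D.profileMap α d t c = c ∧ D.profileMap α d t (-c) = -c := by
  have habs : |c| = c := abs_of_nonneg (hd.1.le.trans hdc)
  constructor <;> apply D.profileMap_eq_self hα hd hdc hc ht <;> simp [habs, hc.le]

lemma abs_profileMap_le (hdc : d ≤ c) (hc : c < 1) (ht : |t| ≤ c) (hs : |s| ≤ c) :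
    |D.profileMap α d t s| ≤ c := by
  obtain ⟨hright, hleft⟩ := D.profileMap_apply_of_eq hα hd hdc hc ht
  have hmono := (D.profileMap_monotoneOn hα hd (ht.trans_lt hc)).mono
    (Icc_subset_Icc (neg_le_neg hc.le) hc.le)
  have := hmono.mapsTo_Icc (abs_le.1 hs)
  rw [hright, hleft] at this
  exact abs_le.2 this

lemma profileMap_mem_Ico (hdc : d ≤ c) (hc : c < 1 / 2) (ht : |t| ≤ c)
    (hs : s ∈ Ico (-1 / 2 : ℝ) (1 / 2)) : D.profileMap α d t s ∈ Ico (-1 / 2 : ℝ) (1 / 2) := by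
  rcases le_total c |s| with hcs | hcs
  · rwa [D.profileMap_eq_self hα hd hdc (by linarith) ht hcs
      (abs_le.2 ⟨by linarith [hs.1], by linarith [hs.2]⟩)]
  · have := abs_le.1 (D.abs_profileMap_le hα hd hdc (by linarith) ht hcs)
    exact ⟨by linarith, by linarith⟩

lemma profileMap_injOn (h0 : t ≠ 0) (ht : |t| < 1) :
    InjOn (D.profileMap α d t) (Icc (-1) 1) :=
  (D.h_bijOn hα h0 ht).injOn.comp (D.hInv_strictMonoOn hα hd).injOn (D.hInv_bijOn hα hd).mapsTo

lemma eq_or_profileMap_zero_eq_zero {s' : ℝ} (hs : s ∈ Icc (-1 : ℝ) 1)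
    (hs' : s' ∈ Icc (-1 : ℝ) 1) (h : D.profileMap α d 0 s = D.profileMap α d 0 s') :
    s = s' ∨ D.profileMap α d 0 s = 0 := by
  obtain ⟨-, hle⟩ := (D.hInv_bijOn hα hd).mapsTo hs
  obtain ⟨-, hle'⟩ := (D.hInv_bijOn hα hd).mapsTo hs'
  have hinv : D.hInv α d s = D.hInv α d s' ∨ D.profileMap α d 0 s = 0 := by
    simp only [profileMap, h_zero] at h ⊢
    grind
  exact hinv.imp_left fun heq => (D.hInv_strictMonoOn hα hd).injOn hs hs' heq

/- `(± 1/2, ± d/2)` are vertices of the graph of `h_d`, and `h_0 (± 1/2) = 0`. -/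
lemma profileMap_zero_half :
    D.profileMap α d 0 (d / 2) = 0 ∧ D.profileMap α d 0 (-d / 2) = 0 := by
  have habs : |d| = d := abs_of_pos hd.1
  have hmem (s : ℝ) (hs : s ∈ Icc (-1 : ℝ) 1) (hvertex : (s, d * s) ∈ D.hVertices α d) :
      D.profileMap α d 0 (d * s) = D.h α 0 s := by
    have hinv := D.hInv_h hα hd hs
    rw [D.h_vertex hα hd.1.ne' (habs.trans_lt hd.2) (by rwa [habs])] at hinv
    rw [profileMap, hinv]
  constructor
  · rw [show d / 2 = d * (1 / 2) by ring, hmem _ (by norm_num)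
      (by simp [hVertices, div_eq_mul_inv]), h_zero]
    norm_num
  · rw [show -d / 2 = d * (-1 / 2) by ring, hmem _ (by norm_num)
      (by simp [hVertices, div_eq_mul_inv]), h_zero]
    norm_num

lemma continuousOn_profileMap :
    ContinuousOn (fun q : ℝ × ℝ => D.profileMap α d q.1 q.2) (Ioo (-1) 1 ×ˢ Icc (-1) 1) :=
  (D.continuousOn_h hα).comp (f := fun q : ℝ × ℝ => (q.1, D.hInv α d q.2))
    (continuousOn_fst.prodMk ((D.continuousOn_hInv hα hd).comp continuousOn_snd fun _ hq => hq.2))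
    fun _ hq => ⟨hq.1, (D.hInv_bijOn hα hd).mapsTo hq.2⟩

lemma profileMap_surjOn (ht : |t| ≤ d) :
    SurjOn (D.profileMap α d t) (Icc (-d) d) (Icc (-d) d) := by
  obtain ⟨hright, hleft⟩ := D.profileMap_apply_of_eq hα hd le_rfl hd.2 ht
  have hcont : ContinuousOn (D.profileMap α d t) (Icc (-d) d) :=
    (D.continuousOn_profileMap hα hd).comp (f := fun s => (t, s)) (by fun_prop)
      fun s hs => ⟨abs_lt.1 (ht.trans_lt hd.2), by linarith [hs.1, hd.2], by linarith [hs.2, hd.2]⟩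
  simpa only [SurjOn, hright, hleft] using intermediate_value_Icc (by linarith [hd.1]) hcont

end ProfileMap

/-- The circle map `v ↦ h^α_t ((h^α_d)⁻¹ v)`, where `v` is read as a number in `[-1/2, 1/2)`: the
action of `Λ_n` on the vertical circle at distance `t` from `z_n`, with `d = δ_n` and `z_n` as the
origin. -/
def fibreMap (α : ℕ → ℝ) (d t : ℝ) (v : UnitAddCircle) : UnitAddCircle :=
  (D.profileMap α d t (rep v) : ℝ)

section FibreMap

variable (hα : ∀ n, α n ∈ Icc (0 : ℝ) 1) {c d t : ℝ} {v w : UnitAddCircle}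
  (hd : d ∈ Ioo (0 : ℝ) (1 / 2))

lemma mem_Ioo_one_of_mem_Ioo_half (hd : d ∈ Ioo (0 : ℝ) (1 / 2)) : d ∈ Ioo (0 : ℝ) 1 :=
  ⟨hd.1, by linarith [hd.2]⟩

include hα hd

lemma rep_fibreMap (hdc : d ≤ c) (hc : c < 1 / 2) (ht : |t| ≤ c) :
    rep (D.fibreMap α d t v) = D.profileMap α d t (rep v) :=
  rep_coe (D.profileMap_mem_Ico hα (mem_Ioo_one_of_mem_Ioo_half hd) hdc hc ht (rep_mem_Ico v))

lemma fibreMap_self (v : UnitAddCircle) : D.fibreMap α d d v = v := by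
  rw [fibreMap, D.profileMap_self hα (mem_Ioo_one_of_mem_Ioo_half hd) (rep_mem_Icc v), coe_rep]

lemma fibreMap_eq_self (ht : |t| ≤ d) (hv : d ≤ ‖v‖) : D.fibreMap α d t v = v := by
  rw [fibreMap, D.profileMap_eq_self hα (mem_Ioo_one_of_mem_Ioo_half hd) le_rfl
    (by linarith [hd.2]) ht (by rwa [abs_rep]) (abs_le.2 (rep_mem_Icc v)), coe_rep]

lemma norm_fibreMap_le (ht : |t| ≤ d) (hv : ‖v‖ ≤ d) : ‖D.fibreMap α d t v‖ ≤ d := by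
  rw [← abs_rep, D.rep_fibreMap hα hd le_rfl hd.2 ht]
  exact D.abs_profileMap_le hα (mem_Ioo_one_of_mem_Ioo_half hd) le_rfl (by linarith [hd.2]) ht
    (by rwa [abs_rep])

lemma fibreMap_injective (h0 : t ≠ 0) (ht : |t| ≤ d) :
    Function.Injective (D.fibreMap α d t) := fun v w hvw => by
  have hrep := congrArg rep hvw
  simp only [D.rep_fibreMap hα hd le_rfl hd.2 ht] at hrep
  exact rep_injective (D.profileMap_injOn hα (mem_Ioo_one_of_mem_Ioo_half hd) h0
    (by linarith [hd.2]) (rep_mem_Icc v) (rep_mem_Icc w) hrep)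

lemma eq_or_fibreMap_zero_eq_zero (hvw : D.fibreMap α d 0 v = D.fibreMap α d 0 w) :
    v = w ∨ D.fibreMap α d 0 v = 0 := by
  have hrep := congrArg rep hvw
  simp only [D.rep_fibreMap hα hd le_rfl hd.2 (abs_zero.trans_le hd.1.le)] at hrep
  refine (D.eq_or_profileMap_zero_eq_zero hα (mem_Ioo_one_of_mem_Ioo_half hd) (rep_mem_Icc v)
    (rep_mem_Icc w) hrep).imp (fun h => rep_injective h) fun h => ?_
  rw [fibreMap, h, AddCircle.coe_zero]

lemma fibreMap_zero_preimage_nontrivial : (D.fibreMap α d 0 ⁻¹' {0}).Nontrivial := by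
  have hpos : rep ((d / 2 : ℝ) : UnitAddCircle) = d / 2 :=
    rep_coe ⟨by linarith [hd.1], by linarith [hd.2]⟩
  have hneg : rep ((-d / 2 : ℝ) : UnitAddCircle) = -d / 2 :=
    rep_coe ⟨by linarith [hd.2], by linarith [hd.1]⟩
  obtain ⟨hpos0, hneg0⟩ := D.profileMap_zero_half hα (mem_Ioo_one_of_mem_Ioo_half hd)
  refine ⟨(d / 2 : ℝ), ?_, (-d / 2 : ℝ), ?_, fun heq => ?_⟩
  · simp [fibreMap, hpos, hpos0]
  · simp [fibreMap, hneg, hneg0]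
  · have := congrArg rep heq
    rw [hpos, hneg] at this
    linarith [hd.1]

lemma fibreMap_surjective (ht : |t| ≤ d) : Function.Surjective (D.fibreMap α d t) := fun w => by
  rcases le_total d ‖w‖ with hw | hw
  · exact ⟨w, D.fibreMap_eq_self hα hd ht hw⟩
  · obtain ⟨s, hs, hsw⟩ := D.profileMap_surjOn hα (mem_Ioo_one_of_mem_Ioo_half hd) ht
      (abs_le.1 ((abs_rep w).trans_le hw))
    refine ⟨s, ?_⟩
    rw [fibreMap, rep_coe ⟨by linarith [hs.1, hd.2], by linarith [hs.2, hd.2]⟩, hsw, coe_rep]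

lemma fibreMap_comp {e : ℝ} (he : e ∈ Ioo (0 : ℝ) (1 / 2)) (t : ℝ) (v : UnitAddCircle) :
    D.fibreMap α e t (D.fibreMap α d e v) = D.fibreMap α d t v := by
  have hrep : rep (D.fibreMap α d e v) = D.profileMap α d e (rep v) :=
    D.rep_fibreMap hα hd (le_max_left d e) (max_lt hd.2 he.2)
      ((abs_of_pos he.1).trans_le (le_max_right d e))
  rw [fibreMap, hrep, D.profileMap_comp hα (mem_Ioo_one_of_mem_Ioo_half hd)
    (mem_Ioo_one_of_mem_Ioo_half he) t (rep_mem_Icc v), fibreMap]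

lemma continuousOn_fibreMap (hdc : d ≤ c) (hc : c < 1 / 2) :
    ContinuousOn (fun q : ℝ × UnitAddCircle => D.fibreMap α d q.1 q.2)
      (Icc (-c) c ×ˢ univ) := by
  refine continuousOn_coe_comp_rep (β := fun q => D.profileMap α d q.1 q.2)
    ((D.continuousOn_profileMap hα (mem_Ioo_one_of_mem_Ioo_half hd)).mono
      (prod_mono (fun t ht => ⟨by linarith [ht.1], by linarith [ht.2]⟩)
        fun s hs => ⟨by linarith [hs.1], by linarith [hs.2]⟩)) hc fun t ht s hs hcs => ?_
  exact D.profileMap_eq_self hα (mem_Ioo_one_of_mem_Ioo_half hd) hdc (by linarith)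
    (abs_le.2 ht) hcs (abs_le.2 ⟨by linarith [hs.1], by linarith [hs.2]⟩)

end FibreMap

lemma A_eq_closedBall (δ : ℕ → ℝ) (n : ℕ) : D.A δ n = Metric.closedBall (D.z n) (δ n) := by
  ext u
  simp [A, abs_rep, dist_eq_norm, Prod.norm_def]

lemma mem_A {δ : ℕ → ℝ} {n : ℕ} {u : Torus} :
    u ∈ D.A δ n ↔ ‖u.1 - (D.z n).1‖ ≤ δ n ∧ ‖u.2 - (D.z n).2‖ ≤ δ n := by
  simp [A, abs_rep]

lemma Lam_of_notMem {δ : ℕ → ℝ} {n : ℕ} {u : Torus} (hu : u ∉ D.A δ n) :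
    D.Lam α δ n u = u :=
  if_neg hu

@[simp] lemma Lam_fst (δ : ℕ → ℝ) (n : ℕ) (u : Torus) : (D.Lam α δ n u).1 = u.1 := by
  unfold Lam
  split_ifs <;> rfl

section Lam

variable (hα : ∀ n, α n ∈ Icc (0 : ℝ) 1) {δ : ℕ → ℝ} {n : ℕ} (hδ : δ n ∈ Ioo (0 : ℝ) (1 / 2))
include hα hδ

lemma Lam_eq (u : Torus) : D.Lam α δ n u =
    (u.1, (D.z n).2 +
      D.fibreMap α (δ n) (min ‖u.1 - (D.z n).1‖ (δ n)) (u.2 - (D.z n).2)) := by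
  have hmin : |min ‖u.1 - (D.z n).1‖ (δ n)| ≤ δ n := by
    rw [abs_of_nonneg (le_min (norm_nonneg _) hδ.1.le)]
    exact min_le_right _ _
  by_cases hu : u ∈ D.A δ n
  · rw [min_eq_left (D.mem_A.1 hu).1, ← abs_rep, fibreMap, profileMap_abs, Lam, if_pos hu,
      profileMap]
  · rw [D.Lam_of_notMem hu]
    rcases le_total ‖u.1 - (D.z n).1‖ (δ n) with hfst | hfst
    · have hsnd : δ n ≤ ‖u.2 - (D.z n).2‖ := by
        by_contra! hlt
        exact hu (D.mem_A.2 ⟨hfst, hlt.le⟩)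
      rw [D.fibreMap_eq_self hα hδ hmin hsnd, add_sub_cancel]
    · rw [min_eq_right hfst, D.fibreMap_self hα hδ, add_sub_cancel]

lemma continuous_Lam : Continuous (D.Lam α δ n) := by
  have hfibre := (D.continuousOn_fibreMap hα hδ le_rfl hδ.2).comp_continuous
    (f := fun u : Torus => (min ‖u.1 - (D.z n).1‖ (δ n), u.2 - (D.z n).2)) (by fun_prop)
    fun u => ⟨⟨by linarith [hδ.1, le_min (norm_nonneg (u.1 - (D.z n).1)) hδ.1.le],
      min_le_right _ _⟩, mem_univ _⟩
  rw [funext (D.Lam_eq hα hδ)]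
  exact continuous_fst.prodMk (continuous_const.add hfibre)

lemma Lam_mem_A {u : Torus} (hu : u ∈ D.A δ n) : D.Lam α δ n u ∈ D.A δ n := by
  rw [D.mem_A] at hu ⊢
  rw [D.Lam_eq hα hδ, min_eq_left hu.1, add_sub_cancel_left]
  exact ⟨hu.1, D.norm_fibreMap_le hα hδ (by simpa using hu.1) hu.2⟩

lemma dist_Lam_le (u : Torus) : dist (D.Lam α δ n u) u ≤ 2 * δ n := by
  by_cases hu : u ∈ D.A δ n
  · have hLam := D.Lam_mem_A hα hδ hu
    rw [A_eq_closedBall, Metric.mem_closedBall] at hu hLam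
    linarith [dist_triangle_right (D.Lam α δ n u) u (D.z n)]
  · rw [D.Lam_of_notMem hu, dist_self]
    linarith [hδ.1]

lemma Lam_surjective : Function.Surjective (D.Lam α δ n) := fun w => by
  have hmin := le_min (norm_nonneg (w.1 - (D.z n).1)) hδ.1.le
  obtain ⟨v, hv⟩ := D.fibreMap_surjective hα hδ
    ((abs_of_nonneg hmin).trans_le (min_le_right _ _)) (w.2 - (D.z n).2)
  refine ⟨(w.1, (D.z n).2 + v), ?_⟩
  rw [D.Lam_eq hα hδ, add_sub_cancel_left, hv, add_sub_cancel]

lemma eq_or_Lam_eq_z {u v : Torus} (huv : D.Lam α δ n u = D.Lam α δ n v) :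
    u = v ∨ (u.1 = (D.z n).1 ∧ D.Lam α δ n u = D.z n) := by
  have hfst : u.1 = v.1 := by simpa using congrArg Prod.fst huv
  have hmin := le_min (norm_nonneg (u.1 - (D.z n).1)) hδ.1.le
  have huv' := D.Lam_eq hα hδ v
  rw [← huv, D.Lam_eq hα hδ u, ← hfst] at huv'
  have hfibre := add_left_cancel (congrArg Prod.snd huv')
  by_cases h0 : u.1 = (D.z n).1
  · have hmin0 : min ‖u.1 - (D.z n).1‖ (δ n) = 0 := by simp [h0, hδ.1.le]
    rw [hmin0] at hfibre
    refine (D.eq_or_fibreMap_zero_eq_zero hα hδ hfibre).imp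
      (fun hsnd => Prod.ext hfst (sub_left_injective hsnd)) fun hzero => ⟨h0, ?_⟩
    rw [D.Lam_eq hα hδ, hmin0, hzero, add_zero, h0]
  · have hne : min ‖u.1 - (D.z n).1‖ (δ n) ≠ 0 :=
      (lt_min (norm_pos_iff.2 (sub_ne_zero.2 h0)) hδ.1).ne'
    exact Or.inl (Prod.ext hfst (sub_left_injective (D.fibreMap_injective hα hδ hne
      ((abs_of_nonneg hmin).trans_le (min_le_right _ _)) hfibre)))

lemma Lam_preimage_z_nontrivial : (D.Lam α δ n ⁻¹' {D.z n}).Nontrivial := by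
  obtain ⟨v, hv, w, hw, hvw⟩ := D.fibreMap_zero_preimage_nontrivial hα hδ
  have hLam (y : UnitAddCircle) (hy : y ∈ D.fibreMap α (δ n) 0 ⁻¹' {0}) :
      D.Lam α δ n ((D.z n).1, (D.z n).2 + y) = D.z n := by
    rw [D.Lam_eq hα hδ, add_sub_cancel_left, sub_self, norm_zero, min_eq_left hδ.1.le,
      show D.fibreMap α (δ n) 0 y = 0 from hy, add_zero]
  exact ⟨_, hLam v hv, _, hLam w hw, fun h => hvw (add_left_cancel (congrArg Prod.snd h))⟩

/- `B` is built from `h_{δ_m} ∘ h_{δ_n}⁻¹`, and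
`h_t ∘ h_{δ_n}⁻¹ = (h_t ∘ h_{δ_m}⁻¹) ∘ (h_{δ_m} ∘ h_{δ_n}⁻¹)`. -/
lemma exists_Lam_add_eq_Lam {m : ℕ} (hδ' : δ m ∈ Ioo (0 : ℝ) (1 / 2)) {c : Torus}
    (hc : D.z m = D.z n + c) :
    ∃ B : Torus → Torus, Continuous B ∧ (∀ v, (B v).1 = v.1) ∧
      ∀ u : Torus, ‖u.1 - (D.z n).1‖ ≤ min (δ n) (δ m) →
        D.Lam α δ n u + c = D.Lam α δ m (B (u + c)) := by
  refine ⟨fun v => (v.1, (D.z m).2 + D.fibreMap α (δ n) (δ m) (v.2 - (D.z m).2)), ?_,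
    fun _ => rfl, fun u hu => ?_⟩
  · refine continuous_fst.prodMk (continuous_const.add ?_)
    exact (D.continuousOn_fibreMap hα hδ (le_max_left (δ n) (δ m))
      (max_lt hδ.2 hδ'.2)).comp_continuous (f := fun v : Torus => (δ m, v.2 - (D.z m).2))
      (by fun_prop) fun _ => ⟨⟨by linarith [hδ'.1, le_max_right (δ n) (δ m)],
        le_max_right _ _⟩, mem_univ _⟩
  · have hfst : u.1 + c.1 - (D.z m).1 = u.1 - (D.z n).1 := by rw [hc, Prod.fst_add]; abel
    have hsnd : u.2 + c.2 - (D.z m).2 = u.2 - (D.z n).2 := by rw [hc, Prod.snd_add]; abel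
    rw [D.Lam_eq hα hδ, D.Lam_eq hα hδ']
    simp only [Prod.fst_add, Prod.snd_add, add_sub_cancel_left, hfst, hsnd,
      min_eq_left (hu.trans (min_le_left _ _)), min_eq_left (hu.trans (min_le_right _ _)),
      D.fibreMap_comp hα hδ hδ']
    refine Prod.ext rfl ?_
    simp only [hc, Prod.snd_add]
    abel

end Lam

end Choices

/-! ### The orbit of `z₀` -/

lemma comap_nhds_le_of_preimage_eq_singleton {K Y : Type*} [TopologicalSpace K] [CompactSpace K]
    [TopologicalSpace Y] [T2Space Y] {f : K → Y} (hf : Continuous f) {y : K}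
    (hy : ∀ u, f u = f y → u = y) : comap f (𝓝 (f y)) ≤ 𝓝 y := by
  have hpre : f ⁻¹' {f y} = {y} := Subset.antisymm hy (singleton_subset_iff.2 rfl)
  simpa only [hpre, nhdsSet_singleton] using hf.isClosedMap.comap_nhds_le (y := f y)

lemma tendsto_of_tendsto_comp {Z K Y : Type*} [TopologicalSpace K] [CompactSpace K]
    [TopologicalSpace Y] [T2Space Y] {f : K → Y} (hf : Continuous f) {y : K}
    (hy : ∀ u, f u = f y → u = y) {g : Z → K} {l : Filter Z}
    (hg : Tendsto (fun z => f (g z)) l (𝓝 (f y))) : Tendsto g l (𝓝 y) :=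
  (tendsto_comap_iff.2 hg).mono_right (comap_nhds_le_of_preimage_eq_singleton hf hy)

lemma tendsto_comap_comap_of_comp_eq {Y Z : Type*} {p : Y → Z} {f : Y → Y} (hf : ∀ u, p (f u) = p u)
    (l : Filter Z) : Tendsto f (comap p l) (comap p l) :=
  tendsto_comap_iff.2 (tendsto_comap.congr fun u => (hf u).symm)

lemma exists_dist_lt_of_preimage_eq_singleton {K Y : Type*} [PseudoMetricSpace K] [CompactSpace K]
    [MetricSpace Y] {f : K → Y} (hf : Continuous f) {y : K} (hy : ∀ u, f u = f y → u = y)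
    {e : ℝ} (he : 0 < e) : ∃ r > 0, ∀ u, dist (f u) (f y) < r → dist u y < e :=
  ((Metric.nhds_basis_ball.comap f).le_basis_iff Metric.nhds_basis_ball).1
    (comap_nhds_le_of_preimage_eq_singleton hf hy) e he

lemma uniformContinuousOn_of_exists_tendsto {K Y : Type*} [UniformSpace K] [CompactSpace K]
    [UniformSpace Y] [T0Space Y] {s : Set K} (hs : Dense s) {f : K → Y}
    (hf : ∀ p, ∃ y, Tendsto f (𝓝[s] p) (𝓝 y)) : UniformContinuousOn f s := by
  have hext := CompactSpace.uniformContinuous_of_continuous (continuous_extendFrom hs hf)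
  refine hext.uniformContinuousOn.congr fun p hp => ?_
  obtain ⟨y, hy⟩ := hf p
  have hfp : f p = y := tendsto_nhds_unique (tendsto_pure_nhds f p)
    (hy.mono_left (pure_le_nhdsWithin hp))
  exact extendFrom_eq (hs p) (hfp ▸ hy)

/-- The exponent of `T` in `z_n`, so that `z_n = T ^ (orbitIndex n) z₀`. -/
def orbitIndex (n : ℕ) : ℤ := if n % 2 = 0 then (n / 2 : ℕ) else -((n / 2 : ℕ) : ℤ) - 1

lemma orbitIndex_injective : Function.Injective orbitIndex := fun m n h => by
  unfold orbitIndex at h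
  split_ifs at h <;> omega

lemma orbitIndex_sigma (n : ℕ) : orbitIndex (sigma n) = orbitIndex n + 1 := by
  unfold orbitIndex sigma
  split_ifs <;> omega

lemma orbitIndex_tau (n : ℕ) : orbitIndex (tau n) = orbitIndex n - 1 := by
  unfold orbitIndex tau
  grind

lemma sigma_tau (n : ℕ) : sigma (tau n) = n :=
  orbitIndex_injective (by rw [orbitIndex_sigma, orbitIndex_tau, sub_add_cancel])

lemma tau_sigma (n : ℕ) : tau (sigma n) = n :=
  orbitIndex_injective (by rw [orbitIndex_tau, orbitIndex_sigma, add_sub_cancel_right])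

lemma rotation_pow_apply (a b : UnitAddCircle) (n : ℕ) (u : Torus) :
    (rotation a b ^ n) u = u + n • (a, b) := by
  induction n with
  | zero => simp
  | succ n ih => rw [pow_succ', Homeomorph.mul_apply, ih, succ_nsmul, ← add_assoc]; rfl

lemma rotation_zpow_apply (a b : UnitAddCircle) (k : ℤ) (u : Torus) :
    (rotation a b ^ k) u = u + k • (a, b) := by
  obtain ⟨n, rfl | rfl⟩ := k.eq_nat_or_neg
  · rw [zpow_natCast, rotation_pow_apply, natCast_zsmul]
  · rw [zpow_neg, zpow_natCast, Homeomorph.inv_apply, Homeomorph.symm_apply_eq,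
      rotation_pow_apply, neg_zsmul, natCast_zsmul, neg_add_cancel_right]

namespace Choices

variable (D : Choices)

lemma z_eq (n : ℕ) : D.z n = D.z₀ + orbitIndex n • ((D.a, D.b) : Torus) := by
  unfold z orbitIndex
  split_ifs <;> exact rotation_zpow_apply D.a D.b _ _

lemma zsmul_a_ne_zero {k : ℤ} (hk : k ≠ 0) : k • D.a ≠ 0 := fun h => by
  have hdense : DenseRange fun n : ℤ => n • D.a := by
    refine (Prod.fst_surjective.denseRange.dense_image continuous_fst
      (D.minimal_rotation 0)).mono ?_
    rintro _ ⟨_, ⟨n, rfl⟩, rfl⟩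
    exact ⟨n, by simp only [rotation_zpow_apply, zero_add, Prod.smul_fst]⟩
  exact addOrderOf_eq_zero_iff.1 (AddCircle.denseRange_zsmul_iff.1 hdense)
    (isOfFinAddOrder_iff_zsmul_eq_zero.2 ⟨k, hk, h⟩)

lemma z_fst_injective : Function.Injective fun n => (D.z n).1 := fun m n h => by
  simp only [z_eq, Prod.fst_add, Prod.smul_fst, add_right_inj] at h
  apply orbitIndex_injective
  by_contra hne
  exact D.zsmul_a_ne_zero (sub_ne_zero.2 hne) (by rw [sub_zsmul, h, add_neg_cancel])

lemma dense_X : Dense D.X := by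
  have hX : D.X = ⋂ n, Prod.fst ⁻¹' {(D.z n).1}ᶜ := by
    ext p
    simp only [X, mem_iInter, mem_preimage, mem_compl_iff, mem_singleton_iff, mem_ofPred_eq, ne_eq]
  have : Nontrivial UnitAddCircle :=
    ⟨D.a, 0, fun h => D.zsmul_a_ne_zero one_ne_zero (by rw [h, smul_zero])⟩
  rw [hX]
  refine dense_iInter_of_isOpen_nat
    (fun n => isOpen_compl_singleton.preimage continuous_fst) fun n => ?_
  have := ConnectedSpace.neBot_nhdsWithin_compl_of_nontrivial_of_t1space (D.z n).1
  exact (dense_compl_singleton (D.z n).1).preimage isOpenMap_fst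

lemma mem_X_congr {u v : Torus} (h : u.1 = v.1) : u ∈ D.X ↔ v ∈ D.X := by
  simp only [X, mem_ofPred_eq, h]

/-- The permutation `π` of the indices describes the action of the translation by `c` on the points
`z_n`, and changes the order only of neighbouring indices, which belong to disjoint squares. It
allows the two sequences of condition 5, for `(σ, T)` and `(τ, T⁻¹)`, to be treated together. -/
structure IsShift (π : ℕ → ℕ) (c : Torus) : Prop where
  z : ∀ n, D.z (π n) = D.z n + c
  surj : Function.Surjective π
  order : ∀ m k, m < k → π k < π m → π m ≤ π k + 5

lemma isShift_sigma : D.IsShift sigma (D.a, D.b) where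
  z n := by rw [z_eq, z_eq, orbitIndex_sigma, add_zsmul, one_zsmul, add_assoc]
  surj := Function.RightInverse.surjective sigma_tau
  order m k _ _ := by unfold sigma at *; split_ifs at * <;> omega

lemma isShift_tau : D.IsShift tau (-(D.a, D.b)) where
  z n := by rw [z_eq, z_eq, orbitIndex_tau, sub_zsmul, one_zsmul, ← add_assoc]
  surj := Function.RightInverse.surjective tau_sigma
  order m k _ _ := by unfold tau at *; split_ifs at * <;> omega

lemma isShift_id : D.IsShift id 0 where
  z _ := (add_zero _).symm
  surj := Function.surjective_id
  order _ _ h1 h2 := absurd h1 h2.not_gt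

namespace IsShift

variable {D} {π : ℕ → ℕ} {c : Torus} (hπ : D.IsShift π c)
include hπ

lemma injective : Function.Injective π := fun m n h => by
  have hz := hπ.z m
  rw [h, hπ.z n, add_left_inj] at hz
  exact D.z_fst_injective (congrArg Prod.fst hz).symm

lemma z_fst (n : ℕ) : (D.z (π n)).1 = (D.z n).1 + c.1 := congrArg Prod.fst (hπ.z n)

lemma add_mem_X {u : Torus} : u + c ∈ D.X ↔ u ∈ D.X := by
  refine ⟨fun h n hn => h (π n) (by rw [hπ.z_fst, Prod.fst_add, hn]), fun h n hn => ?_⟩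
  obtain ⟨m, rfl⟩ := hπ.surj n
  rw [hπ.z_fst, Prod.fst_add, add_left_inj] at hn
  exact h m hn

end IsShift

end Choices

section Iter

variable {L : ℕ → Torus → Torus}

lemma iter_fst (hL : ∀ k u, (L k u).1 = u.1) (n : ℕ) (u : Torus) : (iter L n u).1 = u.1 := by
  induction n with
  | zero => exact hL 0 u
  | succ n ih => exact (hL _ _).trans ih

lemma continuous_iter (hL : ∀ k, Continuous (L k)) (n : ℕ) : Continuous (iter L n) := by
  induction n with
  | zero => exact hL 0
  | succ n ih => exact (hL _).comp ih

lemma iter_surjective (hL : ∀ k, Function.Surjective (L k)) (n : ℕ) :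
    Function.Surjective (iter L n) := by
  induction n with
  | zero => exact hL 0
  | succ n ih => exact (hL _).comp ih

lemma eq_or_exists_of_iter_eq_iter {bad : ℕ → UnitAddCircle → Prop}
    (hfst : ∀ k u, (L k u).1 = u.1) (hL : ∀ k u v, L k u = L k v → u = v ∨ bad k u.1)
    {n : ℕ} {u v : Torus} (huv : iter L n u = iter L n v) : u = v ∨ ∃ k ≤ n, bad k u.1 := by
  induction n with
  | zero => exact (hL 0 u v huv).imp_right fun hbad => ⟨0, le_rfl, hbad⟩
  | succ n ih =>
    rcases hL _ _ _ huv with heq | hbad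
    · exact (ih heq).imp_right fun ⟨k, hk, hbad⟩ => ⟨k, hk.trans (Nat.le_succ n), hbad⟩
    · rw [iter_fst hfst] at hbad
      exact Or.inr ⟨n + 1, le_rfl, hbad⟩

lemma iter_congr {L' : ℕ → Torus → Torus} {n : ℕ} (h : ∀ k ≤ n, L k = L' k) :
    iter L n = iter L' n := by
  induction n with
  | zero => exact h 0 le_rfl
  | succ n ih =>
    simp only [iter, ih fun k hk => h k (hk.trans (Nat.le_succ n)), h (n + 1) le_rfl]

end Iter

/-! ### Rearranged compositions and uniform continuity -/

namespace Choices

variable (D : Choices) {α : ℕ → ℝ}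

/-- The conditions of admissibility on the position of the squares `A_n` alone: they are embedded in
the torus, neighbouring ones are disjoint, and `A_n` avoids the fibres of `z_0, …, z_{n-1}`. -/
structure Tame (δ : ℕ → ℝ) : Prop where
  mem_Ioo : ∀ n, δ n ∈ Ioo (0 : ℝ) (1 / 2)
  disjoint : ∀ m n, m < n → n ≤ m + 5 → Disjoint (D.A δ m) (D.A δ n)
  avoid : ∀ m n, m < n → ∀ u ∈ D.A δ n, u.1 ≠ (D.z m).1

/-- The rearranged composition `Λ_{π(n)} ∘ ⋯ ∘ Λ_{π(0)}`, which is `Φ_n`, `Φ^σ_n` or `Φ^τ_n` for `π`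
equal to `id`, `σ` or `τ`. -/
def PhiPerm (α δ : ℕ → ℝ) (π : ℕ → ℕ) : ℕ → Torus → Torus := iter fun k => D.Lam α δ (π k)

/-- The composition `Λ_{π(n)} ∘ ⋯ ∘ Λ_{π(0)}` with the factor `Λ_{π(m)}` omitted. It is injective
over the fibre of `z_{π(m)}`, where the full composition is not. -/
def PhiOmit (α δ : ℕ → ℝ) (π : ℕ → ℕ) (m : ℕ) : ℕ → Torus → Torus :=
  iter (Function.update (fun k => D.Lam α δ (π k)) m id)

/-- The map `(Λ_{π(n)} ∘ ⋯ ∘ Λ_{π(0)})⁻¹ ∘ R ∘ Φ_n` of `X`, where `R` is the translation by `c`. It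
is `Gam` or `Del` for `R = T`, `π = σ` or `R = T⁻¹`, `π = τ`. -/
def GamPerm (α δ : ℕ → ℝ) (π : ℕ → ℕ) (c : Torus) (n : ℕ) (u : Torus) : Torus :=
  Function.invFunOn (D.PhiPerm α δ π n) D.X (D.Phi α δ n u + c)

@[simp] lemma PhiPerm_fst (δ : ℕ → ℝ) (π : ℕ → ℕ) (n : ℕ) (u : Torus) :
    (D.PhiPerm α δ π n u).1 = u.1 :=
  iter_fst (fun _ _ => D.Lam_fst _ _ _) n u

@[simp] lemma Phi_fst (δ : ℕ → ℝ) (n : ℕ) (u : Torus) : (D.Phi α δ n u).1 = u.1 :=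
  D.PhiPerm_fst δ id n u

lemma update_Lam_fst (δ : ℕ → ℝ) (π : ℕ → ℕ) (m k : ℕ) (u : Torus) :
    (Function.update (fun k => D.Lam α δ (π k)) m id k u).1 = u.1 :=
  (Function.forall_update_iff _ fun _ (L : Torus → Torus) => (L u).1 = u.1).2
    ⟨rfl, fun _ _ => D.Lam_fst _ _ _⟩ k

@[simp] lemma PhiOmit_fst (δ : ℕ → ℝ) (π : ℕ → ℕ) (m n : ℕ) (u : Torus) :
    (D.PhiOmit α δ π m n u).1 = u.1 :=
  iter_fst (D.update_Lam_fst δ π m) n u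

section SmallSquares

variable (hα : ∀ n, α n ∈ Icc (0 : ℝ) 1) {δ : ℕ → ℝ} (hδ : ∀ n, δ n ∈ Ioo (0 : ℝ) (1 / 2))
include hα hδ

lemma continuous_PhiPerm (π : ℕ → ℕ) (n : ℕ) : Continuous (D.PhiPerm α δ π n) :=
  continuous_iter (fun k => D.continuous_Lam hα (hδ (π k))) n

lemma continuous_Phi (n : ℕ) : Continuous (D.Phi α δ n) :=
  D.continuous_PhiPerm hα hδ id n

lemma continuous_PhiOmit (π : ℕ → ℕ) (m n : ℕ) : Continuous (D.PhiOmit α δ π m n) :=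
  continuous_iter ((Function.forall_update_iff _ fun _ L => Continuous L).2
    ⟨continuous_id, fun k _ => D.continuous_Lam hα (hδ (π k))⟩) n

lemma PhiPerm_surjective (π : ℕ → ℕ) (n : ℕ) : Function.Surjective (D.PhiPerm α δ π n) :=
  iter_surjective (fun k => D.Lam_surjective hα (hδ (π k))) n

lemma Phi_surjective (n : ℕ) : Function.Surjective (D.Phi α δ n) :=
  D.PhiPerm_surjective hα hδ id n

lemma PhiOmit_surjective (π : ℕ → ℕ) (m n : ℕ) : Function.Surjective (D.PhiOmit α δ π m n) :=
  iter_surjective ((Function.forall_update_iff _ fun _ L => Function.Surjective L).2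
    ⟨Function.surjective_id, fun k _ => D.Lam_surjective hα (hδ (π k))⟩) n

lemma eq_or_exists_of_PhiPerm_eq {π : ℕ → ℕ} {n : ℕ} {u v : Torus}
    (huv : D.PhiPerm α δ π n u = D.PhiPerm α δ π n v) :
    u = v ∨ ∃ k ≤ n, u.1 = (D.z (π k)).1 :=
  eq_or_exists_of_iter_eq_iter (bad := fun k x => x = (D.z (π k)).1) (fun _ _ => D.Lam_fst _ _ _)
    (fun k _ _ hLam => (D.eq_or_Lam_eq_z hα (hδ (π k)) hLam).imp_right And.left) huv

lemma eq_or_exists_of_PhiOmit_eq {π : ℕ → ℕ} {m n : ℕ} {u v : Torus}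
    (huv : D.PhiOmit α δ π m n u = D.PhiOmit α δ π m n v) :
    u = v ∨ ∃ k ≤ n, k ≠ m ∧ u.1 = (D.z (π k)).1 :=
  eq_or_exists_of_iter_eq_iter (bad := fun k x => k ≠ m ∧ x = (D.z (π k)).1)
    (D.update_Lam_fst δ π m)
    ((Function.forall_update_iff _ fun k (L : Torus → Torus) =>
        ∀ u v, L u = L v → u = v ∨ k ≠ m ∧ u.1 = (D.z (π k)).1).2
      ⟨fun _ _ => Or.inl, fun k hk _ _ hLam =>
        (D.eq_or_Lam_eq_z hα (hδ (π k)) hLam).imp_right fun hz => ⟨hk, hz.1⟩⟩) huv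

lemma PhiPerm_bijOn (π : ℕ → ℕ) (n : ℕ) : BijOn (D.PhiPerm α δ π n) D.X D.X := by
  refine ⟨fun u => (D.mem_X_congr (D.PhiPerm_fst δ π n u)).2, fun u hu v _ huv => ?_,
    fun w hw => ?_⟩
  · exact (D.eq_or_exists_of_PhiPerm_eq hα hδ huv).resolve_right fun ⟨k, _, hk⟩ => hu (π k) hk
  · obtain ⟨u, rfl⟩ := D.PhiPerm_surjective hα hδ π n w
    exact ⟨u, (D.mem_X_congr (D.PhiPerm_fst δ π n u)).1 hw, rfl⟩

lemma Lam_comm {m n : ℕ} (hmn : Disjoint (D.A δ m) (D.A δ n)) (u : Torus) :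
    D.Lam α δ m (D.Lam α δ n u) = D.Lam α δ n (D.Lam α δ m u) := by
  have comm_of_mem {m n : ℕ} (hmn : Disjoint (D.A δ m) (D.A δ n)) (hu : u ∈ D.A δ n) :
      D.Lam α δ m (D.Lam α δ n u) = D.Lam α δ n (D.Lam α δ m u) := by
    rw [D.Lam_of_notMem (disjoint_right.1 hmn (D.Lam_mem_A hα (hδ n) hu)),
      D.Lam_of_notMem (disjoint_right.1 hmn hu)]
  by_cases hn : u ∈ D.A δ n
  · exact comm_of_mem hmn hn
  by_cases hm : u ∈ D.A δ m
  · exact (comm_of_mem hmn.symm hm).symm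
  · rw [D.Lam_of_notMem hn, D.Lam_of_notMem hm, D.Lam_of_notMem hn]

end SmallSquares

lemma IsShift.Phi_add_mem_X {D : Choices} {δ : ℕ → ℝ} {π : ℕ → ℕ} {c : Torus} (hπ : D.IsShift π c)
    {n : ℕ} {u : Torus} (hu : u ∈ D.X) : D.Phi α δ n u + c ∈ D.X :=
  hπ.add_mem_X.2 ((D.mem_X_congr (D.Phi_fst δ n u)).2 hu)

namespace Tame

variable {D} {δ : ℕ → ℝ}

lemma Lam_z (hδ : D.Tame δ) {m n : ℕ} (hmn : m < n) : D.Lam α δ n (D.z m) = D.z m :=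
  D.Lam_of_notMem fun hz => hδ.avoid m n hmn _ hz rfl

lemma Phi_eq_z_of_le (hδ : D.Tame δ) {m n k : ℕ} (hmn : m ≤ n) (hnk : n ≤ k) {u : Torus}
    (hu : D.Phi α δ n u = D.z m) : D.Phi α δ k u = D.z m := by
  induction k, hnk using Nat.le_induction with
  | base => exact hu
  | succ k hnk ih => exact (congrArg _ ih).trans (hδ.Lam_z (by omega))

lemma disjoint_of_near (hδ : D.Tame δ) {m n : ℕ} (hne : m ≠ n) (hn : n ≤ m + 5)
    (hm : m ≤ n + 5) : Disjoint (D.A δ m) (D.A δ n) :=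
  hne.lt_or_gt.elim (fun h => hδ.disjoint m n h hn) fun h => (hδ.disjoint n m h hm).symm

lemma lt_norm_sub (hδ : D.Tame δ) {m n : ℕ} (hmn : m < n) :
    δ n < ‖(D.z m).1 - (D.z n).1‖ := by
  by_contra! hle
  refine hδ.avoid m n hmn ((D.z m).1, (D.z n).2) (D.mem_A.2 ⟨hle, ?_⟩) rfl
  rw [sub_self, norm_zero]
  exact (hδ.mem_Ioo n).1.le

lemma eventually_notMem_A (hδ : D.Tame δ) {m n : ℕ} (hmn : m < n) :
    ∀ᶠ u in comap Prod.fst (𝓝 (D.z m).1), u ∉ D.A δ n := by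
  have hcont : Continuous fun x : UnitAddCircle => ‖x - (D.z n).1‖ := by fun_prop
  filter_upwards [((hcont.tendsto _).comp tendsto_comap).eventually
    (lt_mem_nhds (hδ.lt_norm_sub hmn))] with u hu hA
  exact hu.not_ge (D.mem_A.1 hA).1

section

variable (hα : ∀ n, α n ∈ Icc (0 : ℝ) 1) (hδ : D.Tame δ)
include hα hδ

lemma eq_or_exists_Phi_eq_z {n : ℕ} {u v : Torus} (huv : D.Phi α δ n u = D.Phi α δ n v) :
    u = v ∨ ∃ m ≤ n, D.Phi α δ n u = D.z m := by
  induction n with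
  | zero => exact (D.eq_or_Lam_eq_z hα (hδ.mem_Ioo 0) huv).imp_right fun hz => ⟨0, le_rfl, hz.2⟩
  | succ n ih =>
    rcases D.eq_or_Lam_eq_z hα (hδ.mem_Ioo (n + 1)) huv with heq | hz
    · refine (ih heq).imp_right fun ⟨m, hm, hz⟩ => ⟨m, hm.trans n.le_succ, ?_⟩
      exact hδ.Phi_eq_z_of_le hm n.le_succ hz
    · exact Or.inr ⟨n + 1, le_rfl, hz.2⟩

lemma eq_of_PhiOmit_eq {π : ℕ → ℕ} (hπ : Function.Injective π) {m n : ℕ} {u v : Torus}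
    (hv : v.1 = (D.z (π m)).1) (huv : D.PhiOmit α δ π m n u = D.PhiOmit α δ π m n v) : u = v := by
  refine (D.eq_or_exists_of_PhiOmit_eq hα hδ.mem_Ioo huv).resolve_right ?_
  rintro ⟨k, -, hkm, hk⟩
  have hfst := congrArg Prod.fst huv
  rw [D.PhiOmit_fst, D.PhiOmit_fst, hk, hv] at hfst
  exact hkm (hπ (D.z_fst_injective hfst))

variable {π : ℕ → ℕ} {c : Torus} (hπ : D.IsShift π c)
include hπ

lemma eventually_Lam_comm {m k : ℕ} (hmk : m < k) :
    ∀ᶠ u in comap Prod.fst (𝓝 (D.z (π m)).1),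
      D.Lam α δ (π k) (D.Lam α δ (π m) u) = D.Lam α δ (π m) (D.Lam α δ (π k) u) := by
  rcases lt_or_ge (π m) (π k) with hlt | hge
  · have hA := hδ.eventually_notMem_A hlt
    have hA' := (tendsto_comap_comap_of_comp_eq (D.Lam_fst (α := α) δ (π m)) _).eventually hA
    filter_upwards [hA, hA'] with u hu hLam
    rw [D.Lam_of_notMem hu, D.Lam_of_notMem hLam]
  · have hne : π k ≠ π m := hπ.injective.ne hmk.ne'
    have hnear := hπ.order m k hmk (hge.lt_of_ne hne)
    exact .of_forall <| D.Lam_comm hα hδ.mem_Ioo (hδ.disjoint_of_near hne hnear (by omega))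

lemma eventually_PhiPerm_eq {m n : ℕ} (hmn : m ≤ n) :
    ∀ᶠ u in comap Prod.fst (𝓝 (D.z (π m)).1),
      D.PhiPerm α δ π n u = D.Lam α δ (π m) (D.PhiOmit α δ π m n u) := by
  induction n, hmn using Nat.le_induction with
  | base =>
    refine .of_forall fun u => ?_
    cases m with
    | zero => simp only [PhiPerm, PhiOmit, iter, Function.update_self, id_eq]
    | succ m =>
      have hiter : iter (Function.update (fun k => D.Lam α δ (π k)) (m + 1) id) m =
          iter (fun k => D.Lam α δ (π k)) m :=
        iter_congr fun k hk => Function.update_of_ne (by omega) _ _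
      simp only [PhiPerm, PhiOmit, iter, Function.update_self, hiter, Function.comp_apply, id_eq]
  | succ n hmn ih =>
    have hcomm := (tendsto_comap_comap_of_comp_eq (D.PhiOmit_fst (α := α) δ π m n) _).eventually
      (hδ.eventually_Lam_comm hα hπ (Nat.lt_succ_of_le hmn))
    filter_upwards [ih, hcomm] with u hPhi hLam
    have hne : n + 1 ≠ m := by omega
    change D.Lam α δ (π (n + 1)) (D.PhiPerm α δ π n u) = D.Lam α δ (π m)
      (Function.update (fun k => D.Lam α δ (π k)) m id (n + 1) (D.PhiOmit α δ π m n u))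
    rw [Function.update_of_ne hne, hPhi, hLam]

lemma GamPerm_mem_X {n : ℕ} {u : Torus} (hu : u ∈ D.X) : D.GamPerm α δ π c n u ∈ D.X :=
  Function.invFunOn_mem ((D.PhiPerm_bijOn hα hδ.mem_Ioo π n).surjOn (hπ.Phi_add_mem_X hu))

lemma PhiPerm_GamPerm {n : ℕ} {u : Torus} (hu : u ∈ D.X) :
    D.PhiPerm α δ π n (D.GamPerm α δ π c n u) = D.Phi α δ n u + c :=
  Function.invFunOn_eq ((D.PhiPerm_bijOn hα hδ.mem_Ioo π n).surjOn (hπ.Phi_add_mem_X hu))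

lemma GamPerm_fst {n : ℕ} {u : Torus} (hu : u ∈ D.X) :
    (D.GamPerm α δ π c n u).1 = u.1 + c.1 := by
  have hfst := congrArg Prod.fst (hδ.PhiPerm_GamPerm hα hπ (n := n) hu)
  rwa [D.PhiPerm_fst, Prod.fst_add, D.Phi_fst] at hfst

lemma tendsto_GamPerm_of_PhiPerm_eq {n : ℕ} {p y : Torus} (hp : ∀ m ≤ n, p.1 ≠ (D.z m).1)
    (hy : D.PhiPerm α δ π n y = D.Phi α δ n p + c) :
    Tendsto (D.GamPerm α δ π c n) (𝓝[D.X] p) (𝓝 y) := by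
  refine tendsto_of_tendsto_comp (D.continuous_PhiPerm hα hδ.mem_Ioo π n) (fun u hu => ?_) ?_
  · refine (D.eq_or_exists_of_PhiPerm_eq hα hδ.mem_Ioo hu).resolve_right ?_
    rintro ⟨k, hk, hz⟩
    have hfst := congrArg Prod.fst (hu.trans hy)
    rw [D.PhiPerm_fst, Prod.fst_add, D.Phi_fst, hz, hπ.z_fst, add_left_inj] at hfst
    exact hp k hk hfst.symm
  · rw [hy]
    have hcont := (D.continuous_Phi hα hδ.mem_Ioo n).add_const c
    refine ((hcont.tendsto p).mono_left nhdsWithin_le_nhds).congr' ?_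
    filter_upwards [self_mem_nhdsWithin] with u hu
    exact (hδ.PhiPerm_GamPerm hα hπ hu).symm

lemma eventually_PhiOmit_GamPerm_eq {m n : ℕ} (hmn : m ≤ n) {p : Torus} (hp : p.1 = (D.z m).1)
    {B : Torus → Torus}
    (hB : ∀ u, ‖u.1 - (D.z m).1‖ ≤ min (δ m) (δ (π m)) →
      D.Lam α δ m u + c = D.Lam α δ (π m) (B (u + c))) :
    ∀ᶠ u in 𝓝[D.X] p, D.PhiOmit α δ π m n (D.GamPerm α δ π c n u) =
      B (D.PhiOmit α δ id m n u + c) := by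
  have hfst : Tendsto Prod.fst (𝓝[D.X] p) (𝓝 (D.z m).1) :=
    hp ▸ (continuous_fst.tendsto p).mono_left nhdsWithin_le_nhds
  have hGam : Tendsto (D.GamPerm α δ π c n) (𝓝[D.X] p) (comap Prod.fst (𝓝 (D.z (π m)).1)) := by
    rw [tendsto_comap_iff, hπ.z_fst]
    refine (hfst.add_const c.1).congr' ?_
    filter_upwards [self_mem_nhdsWithin] with u hu
    exact (hδ.GamPerm_fst hα hπ hu).symm
  have hnorm : ∀ᶠ x in 𝓝 (D.z m).1, ‖x - (D.z m).1‖ < min (δ m) (δ (π m)) := by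
    simp_rw [← dist_eq_norm]
    exact Metric.ball_mem_nhds (D.z m).1 (lt_min (hδ.mem_Ioo m).1 (hδ.mem_Ioo (π m)).1)
  filter_upwards [self_mem_nhdsWithin, hfst.eventually hnorm,
    hGam.eventually (hδ.eventually_PhiPerm_eq hα hπ hmn),
    (tendsto_comap_iff.2 hfst).eventually (hδ.eventually_PhiPerm_eq hα D.isShift_id hmn)]
    with u hu hnear hperm hid
  have hPhi : D.Phi α δ n u = D.Lam α δ m (D.PhiOmit α δ id m n u) := hid
  have hspec := hδ.PhiPerm_GamPerm hα hπ (n := n) hu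
  rw [hperm, hPhi, hB _ (by rw [D.PhiOmit_fst]; exact hnear.le)] at hspec
  refine (D.eq_or_Lam_eq_z hα (hδ.mem_Ioo (π m)) hspec).resolve_right fun hz => ?_
  rw [D.PhiOmit_fst] at hz
  exact hδ.GamPerm_mem_X hα hπ hu _ hz.1

lemma exists_tendsto_GamPerm (n : ℕ) (p : Torus) :
    ∃ y, Tendsto (D.GamPerm α δ π c n) (𝓝[D.X] p) (𝓝 y) := by
  by_cases! hp : ∀ m ≤ n, p.1 ≠ (D.z m).1
  · obtain ⟨y, hy⟩ := D.PhiPerm_surjective hα hδ.mem_Ioo π n (D.Phi α δ n p + c)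
    exact ⟨y, hδ.tendsto_GamPerm_of_PhiPerm_eq hα hπ hp hy⟩
  · obtain ⟨m, hmn, hp⟩ := hp
    obtain ⟨B, hBcont, hBfst, hB⟩ :=
      D.exists_Lam_add_eq_Lam hα (hδ.mem_Ioo m) (hδ.mem_Ioo (π m)) (hπ.z m)
    have hcont : Continuous fun u => B (D.PhiOmit α δ id m n u + c) :=
      hBcont.comp ((D.continuous_PhiOmit hα hδ.mem_Ioo id m n).add_const c)
    obtain ⟨y, hy⟩ := D.PhiOmit_surjective hα hδ.mem_Ioo π m n (B (D.PhiOmit α δ id m n p + c))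
    have hyz : y.1 = (D.z (π m)).1 := by
      have hfst := congrArg Prod.fst hy
      rwa [D.PhiOmit_fst, hBfst, Prod.fst_add, D.PhiOmit_fst, hp, ← hπ.z_fst] at hfst
    refine ⟨y, tendsto_of_tendsto_comp (D.continuous_PhiOmit hα hδ.mem_Ioo π m n)
      (fun u => hδ.eq_of_PhiOmit_eq hα hπ.injective hyz) ?_⟩
    rw [hy]
    refine ((hcont.tendsto p).mono_left nhdsWithin_le_nhds).congr' ?_
    filter_upwards [hδ.eventually_PhiOmit_GamPerm_eq hα hπ hmn hp hB] with u hu using hu.symm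

lemma uniformContinuousOn_GamPerm (n : ℕ) :
    UniformContinuousOn (D.GamPerm α δ π c n) D.X :=
  uniformContinuousOn_of_exists_tendsto D.dense_X (hδ.exists_tendsto_GamPerm hα hπ n)

end

end Tame

end Choices

/-! ### Uniform convergence of the conjugated translations -/

lemma uniformCauchySeqOn_of_dist_le_summable {β E : Type*} [PseudoMetricSpace E] {f : ℕ → β → E}
    {s : Set β} {d : ℕ → ℝ} {N : ℕ} (hd : Summable d)
    (hf : ∀ n ≥ N, ∀ u ∈ s, dist (f n u) (f (n + 1) u) ≤ d n) : UniformCauchySeqOn f atTop s := by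
  rw [Metric.uniformCauchySeqOn_iff]
  intro e he
  obtain ⟨M, hM⟩ := Metric.cauchySeq_iff.1 hd.hasSum.tendsto_sum_nat.cauchySeq e he
  have dist_lt {m n : ℕ} (hm : max M N ≤ m) (hmn : m ≤ n) {u : β} (hu : u ∈ s) :
      dist (f m u) (f n u) < e := calc
    dist (f m u) (f n u) ≤ ∑ i ∈ Finset.Ico m n, d i :=
      dist_le_Ico_sum_of_dist_le (f := fun i => f i u) hmn fun hk _ =>
        hf _ ((le_max_right M N).trans (hm.trans hk)) u hu
    _ = ∑ i ∈ Finset.range n, d i - ∑ i ∈ Finset.range m, d i := Finset.sum_Ico_eq_sub _ hmn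
    _ ≤ dist (∑ i ∈ Finset.range n, d i) (∑ i ∈ Finset.range m, d i) := le_abs_self _
    _ < e := hM n (((le_max_left M N).trans hm).trans hmn) m ((le_max_left M N).trans hm)
  refine ⟨max M N, fun m hm n hn u hu => ?_⟩
  rcases le_total m n with hmn | hnm
  · exact dist_lt hm hmn hu
  · rw [dist_comm]
    exact dist_lt hn hnm hu

namespace Choices

variable {D : Choices} {α : ℕ → ℝ}

/-- From index `s + 2` on, the values of `π` are `s + 4, s + 1, s + 6, s + 3, …`, and the earlier
ones are `0, …, s, s + 2` in some order. Both `σ` and `τ` are of this form, so that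
`Λ_{π(n)} ∘ ⋯ ∘ Λ_{π(0)}` differs from `Φ_n` by at most two factors. -/
structure IsZigzag (D : Choices) (α δ : ℕ → ℝ) (π : ℕ → ℕ) (s : ℕ) : Prop where
  base : ∀ u, D.PhiPerm α δ π (s + 1) u = D.Lam α δ (s + 2) (D.Phi α δ s u)
  up : ∀ j, π (2 * j + s + 2) = 2 * j + s + 4
  down : ∀ j, π (2 * j + s + 3) = 2 * j + s + 1

/-- The estimates on the squares from which condition 5 follows: besides bounds on the `δ_n`, the
points that `Φ_k` maps close to `z_j` are close to each other whenever `z_j` comes soon after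
`z_k`. -/
structure Fine (D : Choices) (α δ : ℕ → ℝ) : Prop extends D.Tame δ where
  anti : Antitone δ
  sep : ∀ n, 2 * δ n < dist (D.z n).1 (D.z (n + 2)).1
  small : ∀ r k j, k < r → k < j → j ≤ r + 2 → ∀ u v : Torus,
    dist (D.Phi α δ k u) (D.z j) ≤ δ r → dist (D.Phi α δ k v) (D.z j) ≤ δ r → dist u v < 1 / 2 ^ r

lemma dist_Lam_z_le_iff (hα : ∀ n, α n ∈ Icc (0 : ℝ) 1) {δ : ℕ → ℝ} {n : ℕ}
    (hδ : δ n ∈ Ioo (0 : ℝ) (1 / 2)) {e : ℝ} (he : δ n ≤ e) {u : Torus} :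
    dist (D.Lam α δ n u) (D.z n) ≤ e ↔ dist u (D.z n) ≤ e := by
  by_cases hu : u ∈ D.A δ n
  · have hLam := D.Lam_mem_A hα hδ hu
    rw [A_eq_closedBall, Metric.mem_closedBall] at hu hLam
    exact iff_of_true (hLam.trans he) (hu.trans he)
  · rw [D.Lam_of_notMem hu]

lemma mem_A_of_Lam_mem_A (hα : ∀ n, α n ∈ Icc (0 : ℝ) 1) {δ : ℕ → ℝ} {m n : ℕ}
    (hδ : δ n ∈ Ioo (0 : ℝ) (1 / 2)) (hmn : Disjoint (D.A δ m) (D.A δ n)) {u : Torus}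
    (hu : D.Lam α δ n u ∈ D.A δ m) : u ∈ D.A δ m := by
  by_cases hA : u ∈ D.A δ n
  · exact absurd (D.Lam_mem_A hα hδ hA) (disjoint_left.1 hmn hu)
  · rwa [D.Lam_of_notMem hA] at hu

section

variable (hα : ∀ n, α n ∈ Icc (0 : ℝ) 1) {δ : ℕ → ℝ}
include hα

namespace Tame

variable (hδ : D.Tame δ)
include hδ

lemma isZigzag_sigma : D.IsZigzag α δ sigma 0 where
  base u := D.Lam_comm hα hδ.mem_Ioo (hδ.disjoint 0 2 (by omega) (by omega)) u
  up j := by unfold sigma; grind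
  down j := by unfold sigma; grind

lemma isZigzag_tau : D.IsZigzag α δ tau 1 where
  base u := by
    change D.Lam α δ 0 (D.Lam α δ 3 (D.Lam α δ 1 u)) = D.Lam α δ 3 (D.Lam α δ 1 (D.Lam α δ 0 u))
    rw [D.Lam_comm hα hδ.mem_Ioo (hδ.disjoint 0 3 (by omega) (by omega)),
      D.Lam_comm hα hδ.mem_Ioo (hδ.disjoint 0 1 (by omega) (by omega))]
  up j := by unfold tau; grind
  down j := by unfold tau; grind

variable {π : ℕ → ℕ} {s : ℕ} (hπ : D.IsZigzag α δ π s)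
include hπ

lemma PhiPerm_zigzag (j : ℕ) (u : Torus) :
    D.PhiPerm α δ π (2 * j + s + 1) u = D.Lam α δ (2 * j + s + 2) (D.Phi α δ (2 * j + s) u) := by
  induction j with
  | zero => simpa only [mul_zero, zero_add] using hπ.base u
  | succ j ih =>
    have hindex : 2 * (j + 1) + s = 2 * j + s + 2 := by ring
    rw [hindex]
    change D.Lam α δ (π (2 * j + s + 3)) (D.Lam α δ (π (2 * j + s + 2))
      (D.PhiPerm α δ π (2 * j + s + 1) u)) = D.Lam α δ (2 * j + s + 4)
        (D.Lam α δ (2 * j + s + 2) (D.Lam α δ (2 * j + s + 1) (D.Phi α δ (2 * j + s) u)))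
    rw [ih, hπ.up, hπ.down,
      D.Lam_comm hα hδ.mem_Ioo (hδ.disjoint (2 * j + s + 1) (2 * j + s + 4) (by omega) (by omega)),
      D.Lam_comm hα hδ.mem_Ioo (hδ.disjoint (2 * j + s + 1) (2 * j + s + 2) (by omega) (by omega))]

lemma PhiPerm_zigzag_succ (j : ℕ) (u : Torus) :
    D.PhiPerm α δ π (2 * j + s + 2) u =
      D.Lam α δ (2 * j + s + 4) (D.Lam α δ (2 * j + s + 2) (D.Phi α δ (2 * j + s) u)) := by
  rw [← hδ.PhiPerm_zigzag hα hπ, ← hπ.up]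
  rfl

lemma Phi_mem_A_of_zigzag {j : ℕ} {u : Torus}
    (hu : D.PhiPerm α δ π (2 * j + s + 2) u ∈ D.A δ (2 * j + s + 1)) :
    D.Phi α δ (2 * j + s) u ∈ D.A δ (2 * j + s + 1) := by
  rw [hδ.PhiPerm_zigzag_succ hα hπ] at hu
  exact D.mem_A_of_Lam_mem_A hα (hδ.mem_Ioo _) (hδ.disjoint _ _ (by omega) (by omega))
    (D.mem_A_of_Lam_mem_A hα (hδ.mem_Ioo _) (hδ.disjoint _ _ (by omega) (by omega)) hu)

omit hπ

lemma dist_GamPerm_succ_le {c : Torus} (hshift : D.IsShift π c) {n : ℕ} {r e : ℝ} (he : 0 ≤ e)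
    (hr : δ (n + 1) ≤ r) (hr' : δ (π (n + 1)) ≤ r)
    (hsmall : ∀ u v, dist (D.PhiPerm α δ π n u) (D.z (π (n + 1))) ≤ r →
      dist (D.PhiPerm α δ π n v) (D.z (π (n + 1))) ≤ r → dist u v ≤ e) {u : Torus}
    (hu : u ∈ D.X) : dist (D.GamPerm α δ π c n u) (D.GamPerm α δ π c (n + 1) u) ≤ e := by
  have hv := hδ.PhiPerm_GamPerm hα hshift (n := n) hu
  have hw : D.Lam α δ (π (n + 1)) (D.PhiPerm α δ π n (D.GamPerm α δ π c (n + 1) u)) =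
    D.Lam α δ (n + 1) (D.Phi α δ n u) + c := hδ.PhiPerm_GamPerm hα hshift (n := n + 1) hu
  have hdist (p : Torus) : dist (p + c) (D.z (π (n + 1))) = dist p (D.z (n + 1)) := by
    rw [hshift.z, dist_add_right]
  by_cases hnear : dist (D.Phi α δ n u) (D.z (n + 1)) ≤ r
  · apply hsmall
    · rwa [hv, hdist]
    · rwa [← D.dist_Lam_z_le_iff hα (hδ.mem_Ioo _) hr', hw, hdist,
        D.dist_Lam_z_le_iff hα (hδ.mem_Ioo _) hr]
  · have hA : D.Phi α δ n u ∉ D.A δ (n + 1) := fun h => by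
      rw [A_eq_closedBall] at h
      exact hnear (h.trans hr)
    rw [D.Lam_of_notMem hA] at hw
    have hA' : D.PhiPerm α δ π n (D.GamPerm α δ π c (n + 1) u) ∉ D.A δ (π (n + 1)) := fun h => by
      have hLam := D.Lam_mem_A hα (hδ.mem_Ioo _) h
      rw [hw, A_eq_closedBall, Metric.mem_closedBall, hdist] at hLam
      exact hnear (hLam.trans hr')
    rw [D.Lam_of_notMem hA', ← hv] at hw
    rw [(D.PhiPerm_bijOn hα hδ.mem_Ioo π n).injOn (hδ.GamPerm_mem_X hα hshift hu)
      (hδ.GamPerm_mem_X hα hshift hu) hw, dist_self]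
    exact he

end Tame

namespace Fine

variable (hδ : D.Fine α δ) {π : ℕ → ℕ} {s : ℕ} (hπ : D.IsZigzag α δ π s)
include hδ hπ

lemma dist_Phi_le_of_zigzag {j : ℕ} {u : Torus}
    (hu : dist (D.PhiPerm α δ π (2 * j + s + 1) u) (D.z (2 * j + s + 4)) ≤ δ (2 * j + s + 2)) :
    dist (D.Phi α δ (2 * j + s) u) (D.z (2 * j + s + 4)) ≤ δ (2 * j + s + 2) := by
  rw [hδ.PhiPerm_zigzag hα hπ] at hu
  by_cases hA : D.Phi α δ (2 * j + s) u ∈ D.A δ (2 * j + s + 2)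
  · have hLam := D.Lam_mem_A hα (hδ.mem_Ioo _) hA
    rw [A_eq_closedBall, Metric.mem_closedBall] at hLam
    have hsep := hδ.sep (2 * j + s + 2)
    have htri := dist_triangle_left (D.z (2 * j + s + 2)) (D.z (2 * j + s + 4))
      (D.Lam α δ (2 * j + s + 2) (D.Phi α δ (2 * j + s) u))
    have hfst : dist (D.z (2 * j + s + 2)).1 (D.z (2 * j + s + 2 + 2)).1 ≤
      dist (D.z (2 * j + s + 2)) (D.z (2 * j + s + 4)) := le_max_left _ _
    linarith
  · rwa [D.Lam_of_notMem hA] at hu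

lemma dist_GamPerm_succ_le_geometric {c : Torus} (hshift : D.IsShift π c) {n : ℕ} (hn : s + 1 ≤ n)
    {u : Torus} (hu : u ∈ D.X) :
    dist (D.GamPerm α δ π c n u) (D.GamPerm α δ π c (n + 1) u) ≤ (1 / 2) ^ (n - 1) := by
  obtain ⟨j, rfl | rfl⟩ : ∃ j, n = 2 * j + s + 1 ∨ n = 2 * j + s + 2 := ⟨(n - s - 1) / 2, by omega⟩
  · refine hδ.dist_GamPerm_succ_le hα hshift (r := δ (2 * j + s + 2)) (by positivity) le_rfl
      (by rw [hπ.up]; exact hδ.anti (by omega)) (fun v w hv hw => ?_) hu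
    rw [hπ.up] at hv hw
    have hsmall := hδ.small (2 * j + s + 2) (2 * j + s) (2 * j + s + 4) (by omega) (by omega) le_rfl
      v w (hδ.dist_Phi_le_of_zigzag hα hπ hv) (hδ.dist_Phi_le_of_zigzag hα hπ hw)
    rw [← one_div_pow] at hsmall
    exact hsmall.le.trans (pow_le_pow_of_le_one (by norm_num) (by norm_num) (by omega))
  · refine hδ.dist_GamPerm_succ_le hα hshift (r := δ (2 * j + s + 1)) (by positivity)
      (hδ.anti (by omega)) (by rw [hπ.down]) (fun v w hv hw => ?_) hu
    rw [hπ.down, ← Metric.mem_closedBall, ← A_eq_closedBall] at hv hw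
    have hv' := hδ.Phi_mem_A_of_zigzag hα hπ hv
    have hw' := hδ.Phi_mem_A_of_zigzag hα hπ hw
    rw [A_eq_closedBall] at hv' hw'
    have hsmall := hδ.small (2 * j + s + 1) (2 * j + s) (2 * j + s + 1) (by omega) (by omega)
      (by omega) v w hv' hw'
    rw [← one_div_pow] at hsmall
    exact hsmall.le

lemma uniformCauchySeqOn_GamPerm {c : Torus} (hshift : D.IsShift π c) :
    UniformCauchySeqOn (D.GamPerm α δ π c) atTop D.X := by
  refine uniformCauchySeqOn_of_dist_le_summable (d := fun n => (1 / 2) ^ (n - 1)) (N := s + 1) ?_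
    fun n hn u hu => hδ.dist_GamPerm_succ_le_geometric hα hπ hshift hn hu
  exact (summable_nat_add_iff 1).1 summable_geometric_two

end Fine

end

end Choices

/-! ### The limit -/

lemma torusDist_eq_dist_toLp (p q : Torus) :
    torusDist p q = dist (WithLp.toLp 2 p) (WithLp.toLp 2 q) := by
  rw [WithLp.prod_dist_eq_of_L2]
  rfl

lemma torusDist_self (p : Torus) : torusDist p p = 0 := by rw [torusDist_eq_dist_toLp, dist_self]

lemma torusDist_eq_zero {p q : Torus} : torusDist p q = 0 ↔ p = q := by
  rw [torusDist_eq_dist_toLp, dist_eq_zero, WithLp.toLp_injective 2 |>.eq_iff]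

lemma torusDist_nonneg (p q : Torus) : 0 ≤ torusDist p q := Real.sqrt_nonneg _

lemma continuous_torusDist : Continuous fun q : Torus × Torus => torusDist q.1 q.2 := by
  unfold torusDist
  fun_prop

lemma exists_tendstoUniformlyOn_of_uniformCauchySeqOn {K Y : Type*} [UniformSpace Y]
    [CompleteSpace Y] {f : ℕ → K → Y} {s : Set K} (hf : UniformCauchySeqOn f atTop s) :
    ∃ g : K → Y, TendstoUniformlyOn f g atTop s := by
  have hlim : ∀ u, ∃ y, u ∈ s → Tendsto (fun n => f n u) atTop (𝓝 y) := fun u => by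
    by_cases hu : u ∈ s
    · exact (cauchySeq_tendsto_of_complete (hf.cauchySeq hu)).imp fun _ hy _ => hy
    · exact ⟨f 0 u, fun h => absurd h hu⟩
  choose g hg using hlim
  exact ⟨g, hf.tendstoUniformlyOn_of_tendsto hg⟩

lemma exists_continuous_tendsto_of_uniformCauchySeqOn {K Y : Type*} [UniformSpace K]
    [UniformSpace Y] [T0Space Y] [CompleteSpace Y] {f : ℕ → K → Y} {s : Set K} (hs : Dense s)
    (hf : ∀ n, UniformContinuousOn (f n) s) (hcauchy : UniformCauchySeqOn f atTop s) :
    ∃ g : K → Y, Continuous g ∧ ∀ u ∈ s, Tendsto (fun n => f n u) atTop (𝓝 (g u)) := by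
  obtain ⟨g, hg⟩ := exists_tendstoUniformlyOn_of_uniformCauchySeqOn hcauchy
  have hgs := uniformContinuousOn_iff_restrict.1
    (hg.uniformContinuousOn (Eventually.of_forall hf).frequently)
  refine ⟨hs.extend (s.domRestrict g), (hs.uniformContinuous_extend hgs).continuous, fun u hu => ?_⟩
  rw [hs.extend_of_ind hgs ⟨u, hu⟩]
  exact hg.tendsto_at hu

lemma surjective_of_tendstoUniformly {K Y : Type*} [TopologicalSpace K] [CompactSpace K]
    [MetricSpace Y] {f : ℕ → K → Y} {g : K → Y} (hf : ∀ n, Continuous (f n))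
    (hsurj : ∀ n, Function.Surjective (f n)) (hg : TendstoUniformly f g atTop) :
    Function.Surjective g := by
  have hcont : Continuous g := hg.continuous (Eventually.of_forall hf).frequently
  rw [← range_eq_univ, ← (isCompact_range hcont).isClosed.closure_eq, eq_univ_iff_forall]
  refine fun w => Metric.mem_closure_iff.2 fun e he => ?_
  obtain ⟨n, hn⟩ := (Metric.tendstoUniformly_iff.1 hg e he).exists
  obtain ⟨u, rfl⟩ := hsurj n w
  exact ⟨g u, mem_range_self u, dist_comm (g u) _ ▸ hn u⟩

lemma semiconj_zpow {K Y : Type*} [TopologicalSpace K] [TopologicalSpace Y] {f : K ≃ₜ K}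
    {g : Y ≃ₜ Y} {Φ : K → Y} (h : Function.Semiconj Φ f g) (n : ℤ) :
    Function.Semiconj Φ ⇑(f ^ n) ⇑(g ^ n) := by
  have hinv : Function.Semiconj Φ ⇑f⁻¹ ⇑g⁻¹ :=
    h.inverses_right f.apply_symm_apply g.symm_apply_apply
  induction n with
  | zero => exact fun _ => rfl
  | succ n ih =>
    rw [zpow_add_one, zpow_add_one]
    exact ih.comp_right h
  | pred n ih =>
    rw [zpow_sub_one, zpow_sub_one]
    exact ih.comp_right hinv

section AlmostInjective

variable {K Y : Type*} [TopologicalSpace K] {Φ : K → Y} {s : Set K}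
  (hs : Dense s) (hΦs : ∀ u ∈ s, ∀ v, Φ v = Φ u → v = u)
include hs hΦs

lemma isMinimalHomeo_of_semiconj [TopologicalSpace Y] (hΦ : IsClosedMap Φ) {f : K ≃ₜ K}
    {g : Y ≃ₜ Y} (h : Function.Semiconj Φ f g) (hg : IsMinimalHomeo g) : IsMinimalHomeo f := by
  intro p
  have hdense : Dense (Φ '' closure (range fun n : ℤ => (f ^ n) p)) := by
    refine (hg (Φ p)).mono ?_
    rintro _ ⟨n, rfl⟩
    exact ⟨(f ^ n) p, subset_closure (mem_range_self n), semiconj_zpow h n p⟩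
  have himage : Φ '' closure (range fun n : ℤ => (f ^ n) p) = univ :=
    (hΦ _ isClosed_closure).closure_eq ▸ hdense.closure_eq
  refine dense_closure.1 (hs.mono fun u hu => ?_)
  obtain ⟨v, hv, hvu⟩ := himage.ge (mem_univ (Φ u))
  exact hΦs u hu v hvu ▸ hv

variable [T2Space K]

lemma eq_self_of_comp_eq {f : K → K} (hf : Continuous f) (h : ∀ u, Φ (f u) = Φ u) (u : K) :
    f u = u :=
  congrFun (Continuous.ext_on hs hf continuous_id fun v hv => hΦs v hv (f v) (h v)) u

lemma exists_homeomorph_of_semiconj {T : Y ≃ Y} {S S' : K → K} (hS : Continuous S)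
    (hS' : Continuous S') (h : Function.Semiconj Φ S T) (h' : Function.Semiconj Φ S' T.symm) :
    ∃ F : K ≃ₜ K, Function.Semiconj Φ F T := by
  refine ⟨⟨⟨S, S', fun u => ?_, fun u => ?_⟩, hS, hS'⟩, h⟩
  · refine eq_self_of_comp_eq hs hΦs (hS'.comp hS) (fun u => ?_) u
    rw [Function.comp_apply, h', h, T.symm_apply_apply]
  · refine eq_self_of_comp_eq hs hΦs (hS.comp hS') (fun u => ?_) u
    rw [Function.comp_apply, h, h', T.apply_symm_apply]

end AlmostInjective

namespace Choices

variable {D : Choices} {α δ : ℕ → ℝ}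

lemma A_eq_univ {n : ℕ} (hn : 1 / 2 ≤ δ n) : D.A δ n = univ := by
  have abs_rep_le (x : UnitAddCircle) : |rep x| ≤ 1 / 2 :=
    abs_le.2 ⟨by linarith [(rep_mem_Ico x).1], (rep_mem_Ico x).2.le⟩
  exact eq_univ_of_forall fun u => ⟨(abs_rep_le _).trans hn, (abs_rep_le _).trans hn⟩

lemma Phi_preimage_z_nontrivial (hα : ∀ n, α n ∈ Icc (0 : ℝ) 1)
    (hδ : ∀ n, δ n ∈ Ioo (0 : ℝ) (1 / 2)) (n : ℕ) : (D.Phi α δ n ⁻¹' {D.z n}).Nontrivial := by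
  have hLam := D.Lam_preimage_z_nontrivial hα (hδ n)
  cases n with
  | zero => exact hLam
  | succ n => exact hLam.preimage (D.Phi_surjective hα hδ n)

lemma extends_of_semiconj {Φ S : Torus → Torus} (hΦ : BijOn Φ D.X D.X)
    (hfst : ∀ u, (Φ u).1 = u.1) (hS : ∀ u, Φ (S u) = D.T (Φ u)) : D.Extends Φ S := by
  intro u hu
  have hTu : D.T (Φ u) ∈ D.X := D.isShift_sigma.add_mem_X.2 (hΦ.mapsTo hu)
  have hSu : S u ∈ D.X := (D.mem_X_congr (hfst (S u))).1 (hS u ▸ hTu)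
  rw [← hS, hΦ.injOn.leftInvOn_invFunOn hSu]

lemma limit_fst {Φ : Torus → Torus} (hΦ : TendstoUniformly (D.Phi α δ) Φ atTop)
    (u : Torus) : (Φ u).1 = u.1 := by
  refine tendsto_nhds_unique ((continuous_fst.tendsto (Φ u)).comp (hΦ.tendsto_at u)) ?_
  exact tendsto_const_nhds.congr fun n => (D.Phi_fst δ n u).symm

namespace Admissible

variable (h : D.Admissible α δ)
include h

lemma lt_half (n : ℕ) : δ n < 1 / 2 := by
  by_contra! hn
  have hz : D.z (n + 1) ∈ D.A δ (n + 1) :=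
    D.A_eq_closedBall δ (n + 1) ▸ Metric.mem_closedBall_self (h.pos (n + 1)).le
  exact disjoint_right.1 (h.disjoint n (n + 1) (by omega) (by omega)) hz
    (A_eq_univ hn ▸ mem_univ _)

lemma tame : D.Tame δ where
  mem_Ioo n := ⟨h.pos n, h.lt_half n⟩
  disjoint := h.disjoint
  avoid := h.avoid

lemma tendsto_zero : Tendsto δ atTop (𝓝 0) :=
  squeeze_zero (fun n => (h.pos n).le) (fun n => (h.lt_pow n).le)
    (tendsto_const_nhds.div_atTop (tendsto_pow_atTop_atTop_of_one_lt one_lt_two))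

lemma exists_mul_torusDist_Phi_le : ∃ C > 0, ∀ n m : ℕ, 1 ≤ n → n < m → ∀ u v : Torus,
    1 / (n : ℝ) ≤ torusDist u v → C * torusDist (D.Phi α δ n u) (D.Phi α δ n v) ≤
      torusDist (D.Phi α δ m u) (D.Phi α δ m v) := by
  obtain ⟨a, ha, ⟨C, hC, hlim⟩, hexpand⟩ := h.expand
  refine ⟨C, hC, fun n m hn hm u v huv => (hexpand n m hn hm u v huv).trans' ?_⟩
  refine mul_le_mul_of_nonneg_right ?_ (torusDist_nonneg _ _)
  have factor_mem (r : ℕ) : 1 - 1 / (a r : ℝ) ∈ Icc (0 : ℝ) 1 :=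
    Icc.one_sub_mem ⟨by positivity,
      div_le_one_of_le₀ (by exact_mod_cast one_le_two.trans (ha r)) (by positivity)⟩
  have prod_le {s t : Finset ℕ} (hst : s ⊆ t) :
      ∏ r ∈ t, (1 - 1 / (a r : ℝ)) ≤ ∏ r ∈ s, (1 - 1 / (a r : ℝ)) :=
    Finset.prod_le_prod_of_subset_of_le_one hst (fun r _ => (factor_mem r).1)
      fun r _ _ => (factor_mem r).2
  have hanti : Antitone fun N : ℕ => ∏ r ∈ Finset.Icc 1 N, (1 - 1 / (a r : ℝ)) :=
    fun M N hMN => prod_le (Finset.Icc_subset_Icc_right hMN)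
  exact (hanti.le_of_tendsto hlim m).trans (prod_le (Finset.Icc_subset_Icc_left (by omega)))

section

variable (hα : ∀ n, α n ∈ Icc (0 : ℝ) 1)
include hα

lemma exists_tendstoUniformly : ∃ Φ : Torus → Torus, TendstoUniformly (D.Phi α δ) Φ atTop := by
  suffices UniformCauchySeqOn (D.Phi α δ) atTop univ by
    simpa only [tendstoUniformlyOn_univ] using exists_tendstoUniformlyOn_of_uniformCauchySeqOn this
  refine uniformCauchySeqOn_of_dist_le_summable (N := 0) summable_geometric_two fun n _ u _ => ?_
  have hlt := h.lt_pow (n + 1)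
  have hdist := D.dist_Lam_le hα (h.tame.mem_Ioo (n + 1)) (D.Phi α δ n u)
  rw [← one_div_pow, pow_succ] at hlt
  rw [dist_comm]
  exact hdist.trans (by linarith)

variable {Φ : Torus → Torus} (hΦ : TendstoUniformly (D.Phi α δ) Φ atTop)
include hΦ

lemma continuous_limit : Continuous Φ :=
  hΦ.continuous (Eventually.of_forall (D.continuous_Phi hα h.tame.mem_Ioo)).frequently

lemma limit_surjective : Function.Surjective Φ :=
  surjective_of_tendstoUniformly (D.continuous_Phi hα h.tame.mem_Ioo)
    (D.Phi_surjective hα h.tame.mem_Ioo) hΦ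

omit hα in
lemma limit_eq_z {m n : ℕ} (hmn : m ≤ n) {u : Torus} (hu : D.Phi α δ n u = D.z m) :
    Φ u = D.z m := by
  refine tendsto_nhds_unique (hΦ.tendsto_at u) (tendsto_const_nhds.congr' ?_)
  filter_upwards [eventually_ge_atTop n] with k hk
  exact (h.tame.Phi_eq_z_of_le hmn hk hu).symm

lemma eq_or_exists_limit_eq_z {u v : Torus} (huv : Φ u = Φ v) : u = v ∨ ∃ m, Φ u = D.z m := by
  by_contra! hne
  obtain ⟨C, hC, hexpand⟩ := h.exists_mul_torusDist_Phi_le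
  have torusDist_pos {p q : Torus} (hpq : p ≠ q) : 0 < torusDist p q :=
    (torusDist_nonneg p q).lt_of_ne' (torusDist_eq_zero.not.2 hpq)
  obtain ⟨n, hn⟩ := exists_nat_one_div_lt (torusDist_pos hne.1)
  have hPhi : D.Phi α δ (n + 1) u ≠ D.Phi α δ (n + 1) v := fun hPhi =>
    (h.tame.eq_or_exists_Phi_eq_z hα hPhi).elim hne.1 fun ⟨m, hm, hz⟩ =>
      hne.2 m (h.limit_eq_z hΦ hm hz)
  have hlim : Tendsto (fun m => torusDist (D.Phi α δ m u) (D.Phi α δ m v)) atTop (𝓝 0) := by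
    have hcomp := (continuous_torusDist.tendsto (Φ u, Φ v)).comp
      ((hΦ.tendsto_at u).prodMk_nhds (hΦ.tendsto_at v))
    simpa only [Function.comp_def, huv, torusDist_self] using hcomp
  refine (ge_of_tendsto hlim ?_).not_gt (mul_pos hC (torusDist_pos hPhi))
  filter_upwards [eventually_gt_atTop (n + 1)] with m hm
  exact hexpand (n + 1) m (by omega) hm u v (by exact_mod_cast hn.le)

lemma eq_of_limit_eq {u : Torus} (hu : u ∈ D.X) (v : Torus) (hvu : Φ v = Φ u) : v = u := by
  refine (h.eq_or_exists_limit_eq_z hα hΦ hvu).resolve_right ?_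
  rintro ⟨m, hm⟩
  exact hu m (by rw [← limit_fst hΦ u, ← hvu, hm])

lemma limit_bijOn : BijOn Φ D.X D.X := by
  refine ⟨fun u => (D.mem_X_congr (limit_fst hΦ u)).2,
    fun u _ v hv huv => h.eq_of_limit_eq hα hΦ hv u huv, fun w hw => ?_⟩
  obtain ⟨u, rfl⟩ := h.limit_surjective hα hΦ w
  exact ⟨u, (D.mem_X_congr (limit_fst hΦ u)).1 hw, rfl⟩

lemma existsUnique_limit_eq_iff (w : Torus) : (∃! u, Φ u = w) ↔ ∀ n, w ≠ D.z n := by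
  constructor
  · rintro ⟨u, -, huniq⟩ n rfl
    refine (Phi_preimage_z_nontrivial (D := D) hα h.tame.mem_Ioo n).not_subset_singleton (x := u) ?_
    exact fun v hv => huniq v (h.limit_eq_z hΦ le_rfl hv)
  · intro hw
    obtain ⟨u, rfl⟩ := h.limit_surjective hα hΦ w
    exact ⟨u, rfl, fun v hv =>
      (h.eq_or_exists_limit_eq_z hα hΦ hv).resolve_right fun ⟨m, hm⟩ => hw m (hv ▸ hm)⟩

lemma limit_apply_eq_add {π : ℕ → ℕ} {c : Torus} {s : ℕ} (hshift : D.IsShift π c)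
    (hzigzag : D.IsZigzag α δ π s) {u v : Torus} (hu : u ∈ D.X)
    (hv : Tendsto (fun n => D.GamPerm α δ π c n u) atTop (𝓝 v)) : Φ v = Φ u + c := by
  have index_tendsto (b : ℕ) : Tendsto (fun j => 2 * j + s + b) atTop atTop :=
    tendsto_atTop_mono (fun j => show j ≤ _ by omega) tendsto_id
  have hPhi : TendstoUniformly (fun j => D.Phi α δ (2 * j + s)) Φ atTop :=
    fun V hV => (index_tendsto 0).eventually (hΦ V hV)
  have hleft := hPhi.tendsto_comp (h.continuous_limit hα hΦ).continuousAt
    (hv.comp (index_tendsto 1))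
  have hright := ((hΦ.tendsto_at u).comp (index_tendsto 1)).add_const c
  refine tendsto_nhds_unique (hleft.congr_dist (squeeze_zero (fun _ => dist_nonneg) (fun j => ?_)
    (by simpa using (h.tendsto_zero.comp (index_tendsto 2)).const_mul 2))) hright
  simp only [Function.comp_apply]
  rw [← h.tame.PhiPerm_GamPerm hα hshift hu, h.tame.PhiPerm_zigzag hα hzigzag, dist_comm]
  exact D.dist_Lam_le hα (h.tame.mem_Ioo _) _

lemma exists_continuous_semiconj {π : ℕ → ℕ} {c : Torus} {s : ℕ} (hshift : D.IsShift π c)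
    (hzigzag : D.IsZigzag α δ π s) (hcont : ∀ n, UniformContinuousOn (D.GamPerm α δ π c n) D.X)
    (hcauchy : UniformCauchySeqOn (D.GamPerm α δ π c) atTop D.X) :
    ∃ S : Torus → Torus, Continuous S ∧ Function.Semiconj Φ S (· + c) := by
  obtain ⟨S, hS, hlim⟩ := exists_continuous_tendsto_of_uniformCauchySeqOn D.dense_X hcont hcauchy
  have hΦcont := h.continuous_limit hα hΦ
  exact ⟨S, hS, congrFun (Continuous.ext_on D.dense_X (hΦcont.comp hS) (hΦcont.add_const c)
    fun u hu => h.limit_apply_eq_add hα hΦ hshift hzigzag hu (hlim u hu))⟩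

lemma exists_homeomorph_semiconj : ∃ S : Torus ≃ₜ Torus, Function.Semiconj Φ S D.T := by
  obtain ⟨S, hS, hST⟩ := h.exists_continuous_semiconj hα hΦ D.isShift_sigma
    (h.tame.isZigzag_sigma hα) h.gam_unifCont h.gam_cauchy
  obtain ⟨S', hS', hST'⟩ := h.exists_continuous_semiconj hα hΦ D.isShift_tau
    (h.tame.isZigzag_tau hα) h.del_unifCont h.del_cauchy
  exact exists_homeomorph_of_semiconj (T := D.T.toEquiv) D.dense_X
    (fun _ => h.eq_of_limit_eq hα hΦ) hS hS' hST hST'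

end

end Admissible

end Choices

/-! ### Existence of admissible sequences -/

lemma torusDist_comm (p q : Torus) : torusDist p q = torusDist q p := by
  simp only [torusDist_eq_dist_toLp, dist_comm]

lemma torusDist_triangle (p q r : Torus) : torusDist p r ≤ torusDist p q + torusDist q r := by
  simp only [torusDist_eq_dist_toLp]
  exact dist_triangle _ _ _

lemma torusDist_of_fst_eq {p q : Torus} (h : p.1 = q.1) : torusDist p q = dist p.2 q.2 := by
  rw [torusDist, h, dist_self, zero_pow two_ne_zero, zero_add, Real.sqrt_sq dist_nonneg]

lemma dist_le_torusDist (p q : Torus) : dist p q ≤ torusDist p q :=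
  max_le (Real.le_sqrt_of_sq_le (le_add_of_nonneg_right (sq_nonneg _)))
    (Real.le_sqrt_of_sq_le (le_add_of_nonneg_left (sq_nonneg _)))

lemma torusDist_le_two_mul_dist (p q : Torus) : torusDist p q ≤ 2 * dist p q := by
  have hfst : dist p.1 q.1 ≤ dist p q := le_max_left _ _
  have hsnd : dist p.2 q.2 ≤ dist p q := le_max_right _ _
  refine Real.sqrt_le_iff.2 ⟨by positivity, ?_⟩
  nlinarith [dist_nonneg (x := p.1) (y := q.1), dist_nonneg (x := p.2) (y := q.2)]

lemma exists_seq_of_forall_exists {β : Type*} {G : β → Prop} {P : (ℕ → β) → ℕ → β → Prop} {x : β}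
    (hx : G x) (H : ∀ δ, (∀ n, G (δ n)) → ∀ r, ∃ d, G d ∧ P δ r d)
    (hP : ∀ δ δ' r d, (∀ m < r, δ m = δ' m) → P δ r d → P δ' r d) :
    ∃ δ : ℕ → β, (∀ n, G (δ n)) ∧ ∀ r, P δ r (δ r) := by
  have : Nonempty β := ⟨x⟩
  choose! next hnextG hnextP using H
  obtain ⟨δ, hδ⟩ : ∃ δ : ℕ → β, ∀ r, δ r = next (fun m => if _ : m < r then δ m else x) r :=
    ⟨Nat.strongRec fun r δ => next (fun m => if hm : m < r then δ m hm else x) r,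
      Nat.strongRec_eq _⟩
  have hprefix (r : ℕ) (h : ∀ m < r, G (δ m)) (n : ℕ) : G (if _ : n < r then δ n else x) := by
    split_ifs with hn
    exacts [h n hn, hx]
  have hG (r : ℕ) : G (δ r) := by
    induction r using Nat.strong_induction_on with
    | h r ih =>
      rw [hδ]
      exact hnextG _ (hprefix r ih) r
  refine ⟨δ, hG, fun r => ?_⟩
  have hPr := hnextP _ (hprefix r fun m _ => hG m) r
  rw [← hδ] at hPr
  exact hP _ _ _ _ (fun m hm => dif_pos hm) hPr

lemma eventually_nhdsGT_zero_lt {c : ℝ} (hc : 0 < c) : ∀ᶠ d in 𝓝[>] (0 : ℝ), d < c :=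
  nhdsWithin_le_nhds (eventually_lt_nhds hc)

lemma eventually_forall_dist_lt_of_injective {K Y : Type*} [PseudoMetricSpace K] [CompactSpace K]
    [MetricSpace Y] {g : K → Y} (hg : Continuous g) (hinj : Function.Injective g) {e : ℝ}
    (he : 0 < e) : ∀ᶠ d in 𝓝[>] (0 : ℝ), ∀ v w, dist (g v) (g w) ≤ d → dist v w < e := by
  have hcompact : IsCompact {q : K × K | e ≤ dist q.1 q.2} :=
    (isClosed_le continuous_const continuous_dist).isCompact
  obtain ⟨c, hc, hle⟩ := hcompact.exists_forall_le' (f := fun q => dist (g q.1) (g q.2)) (a := 0)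
    (by fun_prop) fun q hq => dist_pos.2 fun heq => by
      rw [mem_ofPred_eq, hinj heq, dist_self] at hq
      exact hq.not_gt he
  filter_upwards [eventually_nhdsGT_zero_lt hc] with d hd v w hvw
  by_contra! hevw
  exact ((hle (v, w) hevw).trans hvw).not_gt hd

lemma prod_Icc_mul_le {f c : ℕ → ℝ} {n m : ℕ} (hc : ∀ r, 0 ≤ c r)
    (hf : ∀ k ≥ n, c (k + 1) * f k ≤ f (k + 1)) (hnm : n ≤ m) :
    (∏ r ∈ Finset.Icc (n + 1) m, c r) * f n ≤ f m := by
  induction m, hnm using Nat.le_induction with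
  | base => simp
  | succ m hm ih =>
    rw [Finset.prod_Icc_succ_top (by omega), mul_comm (∏ r ∈ _, _), mul_assoc]
    exact (mul_le_mul_of_nonneg_left ih (hc _)).trans (hf m hm)

lemma prod_Icc_one_sub_one_div_sq (N : ℕ) :
    ∏ r ∈ Finset.Icc 1 N, (1 - 1 / (((r + 2) ^ 2 : ℕ) : ℝ)) =
      2 / 3 + 2 / 3 * (1 / ((N : ℝ) + 2)) := by
  induction N with
  | zero => norm_num
  | succ N ih =>
    rw [Finset.prod_Icc_succ_top (by omega), ih]
    push_cast
    field_simp
    ring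

lemma tendsto_prod_Icc_one_sub_one_div_sq :
    Tendsto (fun N : ℕ => ∏ r ∈ Finset.Icc 1 N, (1 - 1 / (((r + 2) ^ 2 : ℕ) : ℝ))) atTop
      (𝓝 (2 / 3)) := by
  simp only [prod_Icc_one_sub_one_div_sq]
  have hlim : Tendsto (fun N : ℕ => 1 / ((N : ℝ) + 2)) atTop (𝓝 0) :=
    tendsto_const_nhds.div_atTop (tendsto_atTop_add_const_right _ _ tendsto_natCast_atTop_atTop)
  simpa using (hlim.const_mul (2 / 3)).const_add (2 / 3)

namespace Choices

variable {D : Choices} {α : ℕ → ℝ}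

lemma Lam_congr {δ δ' : ℕ → ℝ} {n : ℕ} (h : δ n = δ' n) : D.Lam α δ n = D.Lam α δ' n := by
  unfold Lam A
  rw [h]

lemma Phi_congr {δ δ' : ℕ → ℝ} {n : ℕ} (h : ∀ m ≤ n, δ m = δ' m) : D.Phi α δ n = D.Phi α δ' n :=
  iter_congr fun k hk => Lam_congr (h k hk)

/-- The conditions on the size `d` of the square `A_r` when the earlier squares have the sizes
`δ_0, …, δ_{r-1}`. The quadratic factor in `small` leaves room for the losses `1 / (r + 2)^2` in the
expansion estimate, whose product converges. -/
structure IsNextSize (D : Choices) (α δ : ℕ → ℝ) (r : ℕ) (d : ℝ) : Prop where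
  lt_pow : d < 1 / 2 ^ r
  sep : ∀ k ∈ Icc 1 5, 2 * d < dist (D.z r).1 (D.z (r + k)).1
  le : ∀ m < r, d ≤ δ m
  lt_dist : ∀ m < r, d < dist (D.z m).1 (D.z r).1 / r
  fibre : ∀ n, r = n + 1 → ∀ v w : UnitAddCircle,
    torusDist (D.Phi α δ n ((D.z r).1, v)) (D.Phi α δ n ((D.z r).1, w)) ≤ d →
      dist v w < 1 / ((n + 1 : ℕ) : ℝ)
  small : ∀ k < r, ∀ j ≤ r + 2, k < j → ∀ u v : Torus,
    dist (D.Phi α δ k u) (D.z j) ≤ (4 * (r + 2) ^ 2 + 1) * d →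
      dist (D.Phi α δ k v) (D.z j) ≤ (4 * (r + 2) ^ 2 + 1) * d → dist u v < 1 / 2 ^ r

lemma IsNextSize.congr {δ δ' : ℕ → ℝ} {r : ℕ} {d : ℝ} (h : ∀ m < r, δ m = δ' m)
    (hd : D.IsNextSize α δ r d) : D.IsNextSize α δ' r d := by
  have hPhi (k : ℕ) (hk : k < r) : D.Phi α δ k = D.Phi α δ' k :=
    Phi_congr fun m hm => h m (by omega)
  exact
    { hd with
      le := fun m hm => h m hm ▸ hd.le m hm
      fibre := fun n hr => hPhi n (by omega) ▸ hd.fibre n hr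
      small := fun k hk => hPhi k hk ▸ hd.small k hk }

lemma dist_z_fst_pos {m n : ℕ} (h : m ≠ n) : 0 < dist (D.z m).1 (D.z n).1 :=
  dist_pos.2 (D.z_fst_injective.ne h)

section Existence

variable (hα : ∀ n, α n ∈ Icc (0 : ℝ) 1) {δ : ℕ → ℝ}
include hα

section Next

variable (hδ : ∀ n, δ n ∈ Ioo (0 : ℝ) (1 / 2))
include hδ

lemma eq_of_Phi_eq {n m : ℕ} (hnm : n < m) {u v : Torus} (hu : u.1 = (D.z m).1)
    (huv : D.Phi α δ n u = D.Phi α δ n v) : u = v := by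
  refine (D.eq_or_exists_of_PhiPerm_eq hα hδ (π := id) huv).resolve_right ?_
  rintro ⟨k, hk, huk⟩
  have : m = k := D.z_fst_injective (hu.symm.trans huk)
  omega

lemma eventually_dist_lt {k j : ℕ} (hkj : k < j) {K e : ℝ} (hK : 0 < K) (he : 0 < e) :
    ∀ᶠ d in 𝓝[>] (0 : ℝ), ∀ u v : Torus, dist (D.Phi α δ k u) (D.z j) ≤ K * d →
      dist (D.Phi α δ k v) (D.z j) ≤ K * d → dist u v < e := by
  obtain ⟨y, hy⟩ := D.Phi_surjective hα hδ k (D.z j)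
  have hyfst : y.1 = (D.z j).1 := by rw [← hy, D.Phi_fst]
  obtain ⟨r, hr, hlt⟩ := exists_dist_lt_of_preimage_eq_singleton (D.continuous_Phi hα hδ k)
    (fun u hu => (eq_of_Phi_eq hα hδ hkj hyfst hu.symm).symm) (half_pos he)
  rw [hy] at hlt
  filter_upwards [eventually_nhdsGT_zero_mul_left hK (eventually_nhdsGT_zero_lt hr)]
    with d hd u v hu hv
  linarith [hlt u (hu.trans_lt hd), hlt v (hv.trans_lt hd), dist_triangle_right u v y]

lemma eventually_fibre (n : ℕ) {e : ℝ} (he : 0 < e) : ∀ᶠ d in 𝓝[>] (0 : ℝ), ∀ v w : UnitAddCircle,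
    torusDist (D.Phi α δ n ((D.z (n + 1)).1, v)) (D.Phi α δ n ((D.z (n + 1)).1, w)) ≤ d →
      dist v w < e := by
  refine (eventually_forall_dist_lt_of_injective (g := fun v => D.Phi α δ n ((D.z (n + 1)).1, v))
    ((D.continuous_Phi hα hδ n).comp (by fun_prop)) (fun v w hvw => ?_) he).mono
    fun d hd v w hvw => hd v w ((dist_le_torusDist _ _).trans hvw)
  exact congrArg Prod.snd (eq_of_Phi_eq (u := ((D.z (n + 1)).1, v)) hα hδ n.lt_succ_self rfl hvw)

lemma eventually_isNextSize (r : ℕ) : ∀ᶠ d in 𝓝[>] (0 : ℝ), D.IsNextSize α δ r d := by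
  have hsep : ∀ᶠ d in 𝓝[>] (0 : ℝ), ∀ k ∈ Icc 1 5, 2 * d < dist (D.z r).1 (D.z (r + k)).1 :=
    (eventually_all_finite (finite_Icc 1 5)).2 fun k hk => eventually_nhdsGT_zero_mul_left two_pos
      (eventually_nhdsGT_zero_lt (dist_z_fst_pos (by have := hk.1; omega)))
  have hle : ∀ᶠ d in 𝓝[>] (0 : ℝ), ∀ m < r, d ≤ δ m :=
    (eventually_all_finite (finite_lt_nat r)).2 fun m _ =>
      (eventually_nhdsGT_zero_lt (hδ m).1).mono fun _ => le_of_lt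
  have hdist : ∀ᶠ d in 𝓝[>] (0 : ℝ), ∀ m < r, d < dist (D.z m).1 (D.z r).1 / r :=
    (eventually_all_finite (finite_lt_nat r)).2 fun m (hm : m < r) => eventually_nhdsGT_zero_lt
      (div_pos (dist_z_fst_pos hm.ne) (Nat.cast_pos.2 (Nat.zero_lt_of_lt hm)))
  have hfibre : ∀ᶠ d in 𝓝[>] (0 : ℝ), ∀ n, r = n + 1 → ∀ v w : UnitAddCircle,
      torusDist (D.Phi α δ n ((D.z r).1, v)) (D.Phi α δ n ((D.z r).1, w)) ≤ d →
        dist v w < 1 / ((n + 1 : ℕ) : ℝ) := by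
    cases r with
    | zero => exact Eventually.of_forall fun d n hn => by omega
    | succ r =>
      filter_upwards [eventually_fibre hα hδ r (Nat.one_div_cast_pos r.succ_ne_zero)]
      rintro d hd n ⟨rfl⟩
      exact hd
  have hsmall : ∀ᶠ d in 𝓝[>] (0 : ℝ), ∀ k < r, ∀ j ≤ r + 2, k < j → ∀ u v : Torus,
      dist (D.Phi α δ k u) (D.z j) ≤ (4 * (r + 2) ^ 2 + 1) * d →
        dist (D.Phi α δ k v) (D.z j) ≤ (4 * (r + 2) ^ 2 + 1) * d → dist u v < 1 / 2 ^ r :=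
    (eventually_all_finite (finite_lt_nat r)).2 fun k _ =>
      (eventually_all_finite (finite_le_nat (r + 2))).2 fun j _ =>
        eventually_imp_distrib_left.2 fun hkj =>
          eventually_dist_lt hα hδ hkj (by positivity) (by positivity)
  filter_upwards [eventually_nhdsGT_zero_lt (show (0 : ℝ) < 1 / 2 ^ r by positivity),
    hsep, hle, hdist, hfibre, hsmall] with d using IsNextSize.mk

end Next

variable (hδ : ∀ n, δ n ∈ Ioo (0 : ℝ) (1 / 2)) (hnext : ∀ r, D.IsNextSize α δ r (δ r))
include hδ

omit hα in
include hnext in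
lemma fine_of_isNextSize : D.Fine α δ where
  mem_Ioo := hδ
  anti := antitone_nat_of_succ_le fun n => (hnext (n + 1)).le n n.lt_succ_self
  disjoint m n hmn hn := by
    rw [A_eq_closedBall, A_eq_closedBall]
    refine Metric.closedBall_disjoint_closedBall (lt_of_lt_of_le ?_ (le_max_left _ _))
    have hsep := (hnext m).sep (n - m) ⟨by omega, by omega⟩
    rw [Nat.add_sub_cancel' hmn.le] at hsep
    linarith [(hnext n).le m hmn]
  avoid m n hmn u hu hum := by
    have hdist := (D.mem_A.1 hu).1
    rw [← dist_eq_norm, hum] at hdist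
    refine (hdist.trans_lt ((hnext n).lt_dist m hmn)).not_ge ?_
    exact div_le_self dist_nonneg (Nat.one_le_cast.2 (Nat.one_le_of_lt hmn))
  sep n := (hnext n).sep 2 ⟨by omega, by omega⟩
  small r k j hkr hkj hjr u v hu hv := by
    have hle : δ r ≤ (4 * ((r : ℝ) + 2) ^ 2 + 1) * δ r :=
      le_mul_of_one_le_left (hδ r).1.le (by linarith [sq_nonneg ((r : ℝ) + 2)])
    exact (hnext r).small k hkr j hjr hkj u v (hu.trans hle) (hv.trans hle)

lemma torusDist_sub_le_torusDist_Lam (n : ℕ) (p q : Torus) :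
    torusDist p q - 4 * δ n ≤ torusDist (D.Lam α δ n p) (D.Lam α δ n q) := by
  have torusDist_Lam_le (w : Torus) : torusDist (D.Lam α δ n w) w ≤ 2 * δ n :=
    (torusDist_of_fst_eq (D.Lam_fst _ _ _)).trans_le
      ((le_max_right _ _).trans (D.dist_Lam_le hα (hδ n) w))
  have hp := torusDist_Lam_le p
  have hq := torusDist_Lam_le q
  rw [torusDist_comm] at hp
  linarith [torusDist_triangle p (D.Lam α δ n p) q,
    torusDist_triangle (D.Lam α δ n p) (D.Lam α δ n q) q]

omit hα hδ in
include hnext in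
lemma Phi_notMem_A_of_torusDist_lt {n : ℕ} (hn : 1 ≤ n) {u v : Torus}
    (huv : 1 / (n : ℝ) ≤ torusDist u v)
    (hlt : torusDist (D.Phi α δ n u) (D.Phi α δ n v) < 4 * ((n + 1 : ℕ) + 2) ^ 2 * δ (n + 1)) :
    D.Phi α δ n u ∉ D.A δ (n + 1) := by
  intro hu
  rw [A_eq_closedBall, Metric.mem_closedBall] at hu
  have hdist := (dist_le_torusDist _ _).trans_lt hlt
  have hpos : 0 ≤ 4 * (((n + 1 : ℕ) : ℝ) + 2) ^ 2 * δ (n + 1) :=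
    hlt.le.trans' (torusDist_nonneg _ _)
  have hsmall : dist u v < 1 / 2 ^ (n + 1) :=
    (hnext (n + 1)).small n n.lt_succ_self (n + 1) (by omega) n.lt_succ_self u v (by linarith)
      (by linarith [dist_triangle_left (D.Phi α δ n v) (D.z (n + 1)) (D.Phi α δ n u)])
  refine huv.not_gt ?_
  calc torusDist u v ≤ 2 * dist u v := torusDist_le_two_mul_dist u v
    _ < 2 * (1 / 2 ^ (n + 1)) := by gcongr
    _ = 1 / 2 ^ n := by field_simp; ring
    _ ≤ 1 / n := one_div_le_one_div_of_le (by exact_mod_cast hn)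
      (by exact_mod_cast Nat.lt_two_pow_self.le)

include hnext

lemma mul_torusDist_Phi_le_torusDist_Phi_succ {n : ℕ} (hn : 1 ≤ n) {u v : Torus}
    (huv : 1 / (n : ℝ) ≤ torusDist u v) :
    (1 - 1 / (((n + 1 + 2) ^ 2 : ℕ) : ℝ)) * torusDist (D.Phi α δ n u) (D.Phi α δ n v) ≤
      torusDist (D.Phi α δ (n + 1) u) (D.Phi α δ (n + 1) v) := by
  change _ ≤ torusDist (D.Lam α δ (n + 1) (D.Phi α δ n u)) (D.Lam α δ (n + 1) (D.Phi α δ n v))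
  have hnonneg := torusDist_nonneg (D.Phi α δ n u) (D.Phi α δ n v)
  rw [sub_mul, one_mul, one_div_mul_eq_div]
  rcases le_or_gt (4 * δ (n + 1))
    (torusDist (D.Phi α δ n u) (D.Phi α δ n v) / ((n + 1 + 2) ^ 2 : ℕ)) with hle | hlt
  · linarith [torusDist_sub_le_torusDist_Lam (D := D) hα hδ (n + 1) (D.Phi α δ n u) (D.Phi α δ n v)]
  · have hlt' : torusDist (D.Phi α δ n u) (D.Phi α δ n v) <
        4 * ((n + 1 : ℕ) + 2) ^ 2 * δ (n + 1) := by
      rw [div_lt_iff₀ (by positivity)] at hlt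
      push_cast at hlt ⊢
      linarith
    rw [D.Lam_of_notMem (Phi_notMem_A_of_torusDist_lt hnext hn huv hlt'),
      D.Lam_of_notMem (Phi_notMem_A_of_torusDist_lt hnext hn (torusDist_comm u v ▸ huv)
        (by rwa [torusDist_comm]))]
    exact sub_le_self _ (by positivity)

lemma prod_mul_torusDist_Phi_le {n m : ℕ} (hn : 1 ≤ n) (hnm : n ≤ m) {u v : Torus}
    (huv : 1 / (n : ℝ) ≤ torusDist u v) :
    (∏ r ∈ Finset.Icc (n + 1) m, (1 - 1 / (((r + 2) ^ 2 : ℕ) : ℝ))) *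
        torusDist (D.Phi α δ n u) (D.Phi α δ n v) ≤
      torusDist (D.Phi α δ m u) (D.Phi α δ m v) :=
  prod_Icc_mul_le (f := fun k => torusDist (D.Phi α δ k u) (D.Phi α δ k v))
    (fun r => sub_nonneg.2 (div_le_one_of_le₀
      (by exact_mod_cast Nat.one_le_pow 2 (r + 2) (by omega)) (by positivity)))
    (fun k hk => mul_torusDist_Phi_le_torusDist_Phi_succ hα hδ hnext (hn.trans hk)
      ((one_div_le_one_div_of_le (by exact_mod_cast hn) (by exact_mod_cast hk)).trans huv)) hnm

omit hδ hnext

theorem exists_admissible : ∃ δ : ℕ → ℝ, D.Admissible α δ := by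
  obtain ⟨δ, hδ, hnext⟩ := exists_seq_of_forall_exists (G := fun d => d ∈ Ioo (0 : ℝ) (1 / 2))
    (P := D.IsNextSize α) (x := 1 / 4) (by norm_num)
    (fun δ hδ r => ((eventually_mem_set.2 (Ioo_mem_nhdsGT one_half_pos)).and
      (eventually_isNextSize hα hδ r)).exists)
    (fun _ _ _ _ => IsNextSize.congr)
  have hfine := fine_of_isNextSize hδ hnext
  exact ⟨δ,
    { pos := fun n => (hδ n).1
      disjoint := hfine.disjoint
      lt_pow := fun n => (hnext n).lt_pow
      avoid := hfine.avoid
      lt_dist := fun m n => (hnext n).lt_dist m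
      fibre := fun n => (hnext (n + 1)).fibre n rfl
      expand := ⟨fun r => (r + 2) ^ 2, fun n => (Nat.le_self_pow two_ne_zero 2).trans
        (Nat.pow_le_pow_left (Nat.le_add_left 2 n) 2),
        ⟨2 / 3, by norm_num, tendsto_prod_Icc_one_sub_one_div_sq⟩,
        fun n m hn hnm u v => prod_mul_torusDist_Phi_le hα hδ hnext hn hnm.le⟩
      gam_unifCont := hfine.uniformContinuousOn_GamPerm hα D.isShift_sigma
      del_unifCont := hfine.uniformContinuousOn_GamPerm hα D.isShift_tau
      gam_cauchy := hfine.uniformCauchySeqOn_GamPerm hα (hfine.isZigzag_sigma hα) D.isShift_sigma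
      del_cauchy := hfine.uniformCauchySeqOn_GamPerm hα (hfine.isZigzag_tau hα) D.isShift_tau }⟩

end Existence

end Choices

end TorusMinimal

end

open TorusMinimal

theorem mainTheorem6 (D : Choices) (α : ℕ → ℝ) (hα : ∀ n, α n ∈ Icc (0 : ℝ) 1) :
    (∃ δ : ℕ → ℝ, D.Admissible α δ) ∧
    ∀ δ : ℕ → ℝ, D.Admissible α δ →
      ∃ Φ : Torus → Torus,
        TendstoUniformly (D.Phi α δ) Φ atTop ∧
        Continuous Φ ∧ Function.Surjective Φ ∧ BijOn Φ D.X D.X ∧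
        (∀ w : Torus, (∃! u, Φ u = w) ↔ ∀ n, w ≠ D.z n) ∧
        ∃ S : Torus ≃ₜ Torus,
          D.Extends Φ S ∧
          (∀ g : Torus → Torus, Continuous g → D.Extends Φ g → g = S) ∧
          (∀ u, Φ (S u) = D.T (Φ u)) ∧
          IsMinimalHomeo S := by
  refine ⟨Choices.exists_admissible hα, fun δ h => ?_⟩
  obtain ⟨Φ, hΦ⟩ := h.exists_tendstoUniformly hα
  obtain ⟨S, hS⟩ := h.exists_homeomorph_semiconj hα hΦ
  have hE : D.Extends Φ S :=
    Choices.extends_of_semiconj (h.limit_bijOn hα hΦ) (Choices.limit_fst hΦ) hS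
  refine ⟨Φ, hΦ, h.continuous_limit hα hΦ, h.limit_surjective hα hΦ, h.limit_bijOn hα hΦ,
    h.existsUnique_limit_eq_iff hα hΦ, S, hE, fun g hg hgE => ?_, hS,
    isMinimalHomeo_of_semiconj D.dense_X (fun _ => h.eq_of_limit_eq hα hΦ)
      (h.continuous_limit hα hΦ).isClosedMap hS D.minimal_rotation⟩
  exact Continuous.ext_on D.dense_X hg S.continuous fun u hu => (hgE u hu).trans (hE u hu).symm
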